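/- Fix a category of diagrams $\mathsf{Dia}$: a full sub-2-category of the 2-category of small categories that contains the finite posets and is closed under isomorphism, finite coproducts, finite products, the comma categories $(k/u)$ and $(u/k)$ of a functor $u\colon J\to K$ and an object $k\in K$, opposites, and Grothendieck fibrations with base and fibres in $\mathsf{Dia}$ (for instance, all small categories). A prederivator is a pseudofunctor $\mathbb D\colon\mathsf{Dia}^{\mathrm{op}}\to\mathsf{CAT}$ (in particular, any strict 2-functor), contravariant on functors and covariant on natural transformations; prederivators, pseudonatural transformations and modifications form the 2-category $\mathsf{PDer}$. For $u\colon J\to K$ write $u^*\colon\mathbb D(K)\to\mathbb D(J)$. A derivator is a prederivator such that (1) $\mathbb D$ sends finite coproducts to products, up to equivalence; (2) a morphism of $\mathbb D(J)$ is invertible as soon as its restrictions to all objects $j\in J$ are; (3) each $u^*$ has a left adjoint $u_!$ and a right adjoint $u_*$; (4) for $u\colon J\to K$ and $k\in K$ the canonical mates $k^*u_*\to (\mathrm{pt}_{(k/u)})_*\,\mathrm{pr}^*$ and $(\mathrm{pt}_{(u/k)})_!\,\mathrm{pr}^*\to k^*u_!$ are invertible, where $\mathrm{pt}_A\colon A\to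 e$ is the functor to the terminal category. Let $[1]=\{0<1\}$, $\square=[1]\times[1]$, and $\mathbb D^{[1]}(J)=\mathbb D(J\times[1])$; an $X\in\mathbb D^{[1]}(J)$ has an underlying arrow $\mathrm{dia}_{[1]}X\colon X_0\to X_1$ in $\mathbb D(J)$, where $X_i=(\mathrm{id}_J,i)^*X$. A finite category here means a category with finitely many objects and arrows whose only endomorphisms are the identities (equivalently, a category with finitely many objects and arrows which is equivalent to one whose nerve has finitely many nondegenerate simplices). A morphism $L\colon\mathbb D\to\mathbb E$ of derivators commutes with right Kan extensions along $u\colon A\to B$ if the canonical map $L_B(u_*Y)\to u_*(L_AY)$ is invertible for all $Y\in\mathbb D(A)$. Let $L\colon\mathbb D\rightleftarrows\mathbb E\colon R$, $L\dashv R$, be an adjunction in $\mathsf{PDer}$ between derivators which is a reflection, i.e. its counit $LR\to\mathrm{id}$ is invertible. Let $\mathbb{Chr}_L\subseteq\mathbb D^{[1]}$ be the full sub-prederivator of those $X\in\mathbb D^{[1]}(J)$ for which $X_1$ lies in the essential image of $R_J$, and assume that the reflection is choric: the morphism $R^\sharp\colon\mathbb{Chr}_L\to\mathbb D$, $X\mapsto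 X_0$, has a left adjoint in $\mathsf{PDer}$. Let $\mathbb S_L\subseteq\mathbb D^{[1]}$ be the sub-prederivator of those $X\in\mathbb D^{[1]}(J)$ such that $\mathrm{dia}_{[1]}(LX)$ is an isomorphism of $\mathbb E(J)$. Then the following conditions are equivalent: - (CF1) $L$ commutes with finite limits, i.e. with right Kan extensions along $A\to e$ for every finite $A\in\mathsf{Dia}$; - (CF1$'$) the reflection is left exact, i.e. $L$ commutes with right Kan extensions along all functors between finite categories in $\mathsf{Dia}$; - (CF2) $\mathbb S_L$ is homotopy pullback stable: if $X\in\mathbb D(\square)$ is cartesian (the unit $X\to i_*i^*X$ is invertible, $i$ being the inclusion of the full subcategory of $\square$ on the objects $\neq(0,0)$) and its edge $X_{(0,1)}\to X_{(1,1)}$ lies in $\mathbb S_L(e)$, then its parallel edge $X_{(0,0)}\to X_{(1,0)}$ lies in $\mathbb S_L(e)$; - (CF3) $\mathbb S_L$ is closed under finite right Kan extensions: for every functor $u\colon A\to B$ between finite categories in $\mathsf{Dia}$ and every $X\in\mathbb S_L(A)$, one has $(u\times[1])_*X\in\mathbb S_L(B)$. -/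

import Mathlib

open CategoryTheory Bicategory Opposite
open scoped CategoryTheory.Pseudofunctor.StrongTrans

universe w v u

namespace Derivators

/-- The poset `[1] = {0 < 1}`, regarded as a category. -/
abbrev Interval : Type w := ULift.{w} (Fin 2)

lemma eq_conj_eqToHom_refl {C : Type*} [Category* C] {f g : C} (θ : f ⟶ g) :
    θ = eqToHom rfl ≫ θ ≫ eqToHom rfl := by simp

section
universe w₁ w₂ v₁ v₂ u₁ u₂
variable {B : Type u₁} {C : Type u₂} [Bicategory.{w₁, v₁} B]
  [Strict B] [Bicategory.{w₂, v₂} C] (F : Pseudofunctor B C)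

/-- The isomorphisms `F(f') F(j) ≅ F(i) F(f)` attached to commutative squares are natural. -/
lemma isoMap_nat {a b a' b' : B} {f g : a ⟶ b} {f' g' : a' ⟶ b'} (i : a' ⟶ a) (j : b' ⟶ b)
    (d e : a' ⟶ b) (hf' : f' ≫ j = d) (hf : i ≫ f = d) (hg' : g' ≫ j = e) (hg : i ≫ g = e)
    (α : f ⟶ g) (α' : f' ⟶ g') (θ : d ⟶ e)
    (h₁ : α' ▷ j = eqToHom hf' ≫ θ ≫ eqToHom hg'.symm)
    (h₂ : i ◁ α = eqToHom hf ≫ θ ≫ eqToHom hg.symm) :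
    F.map₂ α' ▷ F.map j ≫ ((F.mapComp' g' j e hg').symm ≪≫ F.mapComp' i g e hg).hom =
      ((F.mapComp' f' j d hf').symm ≪≫ F.mapComp' i f d hf).hom ≫ F.map i ◁ F.map₂ α := by
  have k₁ : F.map₂ α' ▷ F.map j ≫ (F.mapComp' g' j e hg').inv =
      (F.mapComp' f' j d hf').inv ≫ F.map₂ θ := by
    subst hf' hg'
    obtain rfl : α' ▷ j = θ := by simpa using h₁
    simp [Pseudofunctor.mapComp'_eq_mapComp]
  have k₂ : F.map₂ θ ≫ (F.mapComp' i g e hg).hom =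
      (F.mapComp' i f d hf).hom ≫ F.map i ◁ F.map₂ α := by
    subst hf hg
    obtain rfl : i ◁ α = θ := by simpa using h₂
    simp [Pseudofunctor.mapComp'_eq_mapComp]
  simp only [Iso.trans_hom, Iso.symm_hom, Category.assoc, reassoc_of% k₁, k₂]

/-- The isomorphism attached to a commutative square with two identity sides. -/
lemma isoMap_id {a b : B} (i : a ⟶ b) :
    ((F.mapComp' (𝟙 a) i i (Strict.id_comp i)).symm ≪≫
        F.mapComp' i (𝟙 b) i (Strict.comp_id i)).hom ≫ F.map i ◁ (F.mapId b).hom =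
      (F.mapId a).hom ▷ F.map i ≫ (λ_ _).hom ≫ (ρ_ _).inv := by
  rw [F.mapComp'_comp_id, F.mapComp'_id_comp]
  simp [← Bicategory.whiskerLeft_comp]

/-- The isomorphisms attached to commutative squares are compatible with pasting. -/
lemma isoMap_comp {a b c a' b' c' : B} (f : a ⟶ b) (g : b ⟶ c) (f' : a' ⟶ b') (g' : b' ⟶ c')
   (i : a' ⟶ a) (j : b' ⟶ b) (k : c' ⟶ c) (d₁ : a' ⟶ b) (d₂ : b' ⟶ c) (d : a' ⟶ c)
   (hf' : f' ≫ j = d₁) (hf : i ≫ f = d₁) (hg' : g' ≫ k = d₂) (hg : j ≫ g = d₂) 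
   (hfg' : (f' ≫ g') ≫ k = d) (hfg : i ≫ (f ≫ g) = d) :
   ((F.mapComp' (f' ≫ g') k d hfg').symm ≪≫ F.mapComp' i (f ≫ g) d hfg).hom ≫
       F.map i ◁ (F.mapComp f g).hom =
     (F.mapComp f' g').hom ▷ F.map k ≫ (α_ _ _ _).hom ≫
       F.map f' ◁ ((F.mapComp' g' k d₂ hg').symm ≪≫ F.mapComp' j g d₂ hg).hom ≫ (α_ _ _ _).inv ≫
        ((F.mapComp' f' j d₁ hf').symm ≪≫ F.mapComp' i f d₁ hf).hom ▷ F.map g ≫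
          (α_ _ _ _).hom := by
  have e₁ : f' ≫ d₂ = d := by rw [← hg', ← hfg', Strict.assoc]
  have e₂ : d₁ ≫ g = d := by rw [← hf, ← hfg, Strict.assoc]
  have k₁ := F.mapComp'₀₁₃_hom_comp_whiskerLeft_mapComp'_hom i f g d₁ (f ≫ g) d hf rfl hfg
  have k₂ := F.mapComp'₀₂₃_inv_comp_mapComp'₀₁₃_hom f' g' k (f' ≫ g') d₂ d rfl hg' hfg'
  have k₃ := F.mapComp'₀₁₃_inv_comp_mapComp'₀₂₃_hom f' j g d₁ d₂ d hf' hg e₁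
  have k₄ := (F.mapComp' (f' ≫ g') k d hfg').inv ≫= (Iso.hom_inv_id_assoc
    (F.mapComp' f' d₂ d e₁) (F.mapComp' d₁ g d e₂).hom).symm
  rw [← F.mapComp'_eq_mapComp, ← F.mapComp'_eq_mapComp]
  simp only [Iso.trans_hom, Iso.symm_hom, Category.assoc, Bicategory.whiskerLeft_comp,
    comp_whiskerRight]
  rw [k₁, ← Category.assoc, k₄, k₃, reassoc_of% k₂]
  simp
end

/-- The canonical 2-cell of the comma square of `k` and `u`. -/
def underCell {J K : Type*} [Category* J] [Category* K] (u : J ⥤ K) (k : K) :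
    Functor.star.{w} (StructuredArrow k u) ⋙ Functor.fromPUnit k ⟶ StructuredArrow.proj k u ⋙ u where
  app x := x.hom
  naturality _ _ f := (Category.id_comp _).trans (StructuredArrow.w f).symm

/-- The canonical 2-cell of the comma square of `u` and `k`. -/
def overCell {J K : Type*} [Category* J] [Category* K] (u : J ⥤ K) (k : K) :
    CostructuredArrow.proj u k ⋙ u ⟶
      Functor.star.{w} (CostructuredArrow u k) ⋙ Functor.fromPUnit k where
  app x := x.hom
  naturality _ _ f := (CostructuredArrow.w f).trans (Category.comp_id _).symm

/-- The canonical 2-cell between the inclusions of `J` in `J × [1]` at `0` and at `1`. -/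
def intervalCell (J : Type*) [Category* J] :
    Prod.sectL J (⟨0⟩ : Interval.{w}) ⟶ Prod.sectL J (⟨1⟩ : Interval.{w}) where
  app j := (𝟙 j, homOfLE (by simp))
  naturality _ _ f := Prod.ext ((Category.comp_id _).trans (Category.id_comp _).symm) rfl

/-- A category of diagrams: a full sub-2-category `Dia` of the 2-category of small categories,
given by its class of objects, which contains the finite posets and is closed under isomorphism,
finite coproducts, finite products, comma categories of functors over and under an object,
opposites, and Grothendieck fibrations with base and fibres in `Dia`. -/
class IsDiagramCategory (𝒟 : ObjectProperty Cat.{w, w}) : Prop where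
  isClosedUnderIsomorphisms : 𝒟.IsClosedUnderIsomorphisms
  finite_poset (J : Type w) [SmallCategory J] [Finite J] [Quiver.IsThin J] :
    Skeletal J → 𝒟 (Cat.of J)
  sum (J K : Type w) [SmallCategory J] [SmallCategory K] :
    𝒟 (Cat.of J) → 𝒟 (Cat.of K) → 𝒟 (Cat.of (J ⊕ K))
  prod (J K : Type w) [SmallCategory J] [SmallCategory K] :
    𝒟 (Cat.of J) → 𝒟 (Cat.of K) → 𝒟 (Cat.of (J × K))
  structuredArrow {J K : Type w} [SmallCategory J] [SmallCategory K] (u : J ⥤ K) (k : K) :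
    𝒟 (Cat.of J) → 𝒟 (Cat.of K) → 𝒟 (Cat.of (StructuredArrow k u))
  costructuredArrow {J K : Type w} [SmallCategory J] [SmallCategory K] (u : J ⥤ K) (k : K) :
    𝒟 (Cat.of J) → 𝒟 (Cat.of K) → 𝒟 (Cat.of (CostructuredArrow u k))
  opposite (J : Type w) [SmallCategory J] : 𝒟 (Cat.of J) → 𝒟 (Cat.of Jᵒᵖ)
  fibration {J K : Type w} [SmallCategory J] [SmallCategory K] (p : J ⥤ K) [p.IsFibered] :
    𝒟 (Cat.of K) → (∀ k : K, 𝒟 (Cat.of (p.Fiber k))) → 𝒟 (Cat.of J)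

variable (𝒟 : ObjectProperty Cat.{w, w})

/-- The objects of `Dia`: small categories in the given class. -/
structure Dia where
  carrier : Type w
  [str : SmallCategory carrier]
  mem : 𝒟 (Cat.of carrier)

instance : CoeSort (Dia 𝒟) (Type w) := ⟨Dia.carrier⟩

attribute [instance] Dia.str

/-- The 2-category `Dia`: 1-cells are functors and 2-cells are natural transformations. -/
instance : Bicategory (Dia 𝒟) where
  Hom J K := J ⥤ K
  id J := 𝟭 J
  comp u v := u ⋙ v
  homCategory J K := inferInstanceAs (Category (J ⥤ K))
  whiskerLeft u _ _ α := Functor.whiskerLeft u α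
  whiskerRight α v := Functor.whiskerRight α v
  associator u v w := Functor.associator u v w
  leftUnitor u := Functor.leftUnitor u
  rightUnitor u := Functor.rightUnitor u

set_option linter.checkUnivs false in
/-- A prederivator: a contravariant (pseudo)functor `Diaᵒᵖ ⥤ Cat` of 2-categories; it reverses the
direction of 1-cells and preserves that of 2-cells. With the pseudonatural transformations and the
modifications, the prederivators form the 2-category `PDer`. -/
abbrev Prederivator := Pseudofunctor (Dia 𝒟)ᵒᵖ Cat.{v, u}

variable {𝒟}

/-- A functor, as a 1-cell of `Dia`. -/
abbrev Dia.hom {J K : Dia 𝒟} (u : J ⥤ K) : J ⟶ K := u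

/-- A natural transformation, as a 2-cell of `Dia`. -/
abbrev Dia.hom₂ {J K : Dia 𝒟} {u u' : J ⥤ K} (α : u ⟶ u') : Dia.hom u ⟶ Dia.hom u' := α

lemma Dia.hom₂_op_ext {J K : (Dia 𝒟)ᵒᵖ} {f g : J ⟶ K} {α β : f ⟶ g}
    (h : ∀ x : K.unop, NatTrans.app α.unop2 x = NatTrans.app β.unop2 x) : α = β := by
  obtain ⟨α⟩ := α
  obtain ⟨β⟩ := β
  exact congrArg _ (NatTrans.ext (funext h))

namespace Prederivator

variable (D E : Prederivator.{w, v, u} 𝒟)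

/-- The category `D(J)` of coherent diagrams of shape `J`. -/
abbrev cat (J : Dia 𝒟) : Cat.{v, u} := D.obj (op J)

/-- The restriction functor `u^* : D(K) ⥤ D(J)` along `u : J ⥤ K`. -/
abbrev pull {J K : Dia 𝒟} (u : J ⥤ K) : D.cat K ⥤ D.cat J :=
  (D.map (Dia.hom u).op).toFunctor

/-- The transformation `α^* : u^* ⟶ u'^*` induced by `α : u ⟶ u'`. -/
abbrev pullMap {J K : Dia 𝒟} {u u' : J ⥤ K} (α : u ⟶ u') : D.pull u ⟶ D.pull u' :=
  (D.map₂ (Bicategory.Opposite.op2 (Dia.hom₂ α))).toNatTrans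

/-- The coherence isomorphism `(u ⋙ v)^* ≅ v^* ⋙ u^*`. -/
abbrev pullComp {J K M : Dia 𝒟} (u : J ⥤ K) (v : K ⥤ M) :
    D.pull (u ⋙ v) ≅ D.pull v ⋙ D.pull u :=
  Cat.Hom.toNatIso (D.mapComp (Dia.hom v).op (Dia.hom u).op)

end Prederivator

section Shapes
variable (𝒟) [IsDiagramCategory 𝒟]

lemma mem_of_partialOrder (J : Type w) [PartialOrder J] [Finite J] : 𝒟 (Cat.of J) :=
  IsDiagramCategory.finite_poset J fun _ _ ⟨e⟩ => le_antisymm e.hom.le e.inv.le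

/-- The terminal category `e`. -/
abbrev Dia.pt : Dia 𝒟 := .mk (Discrete PUnit.{w + 1})
  (IsDiagramCategory.finite_poset _ fun _ _ _ => Subsingleton.elim _ _)

/-- The category `[1]`. -/
abbrev Dia.interval : Dia 𝒟 := .mk Interval.{w} (mem_of_partialOrder 𝒟 _)

variable {𝒟}
/-- The product of two diagrams. -/
abbrev Dia.prod (J K : Dia 𝒟) : Dia 𝒟 := .mk (J × K)
  (IsDiagramCategory.prod J K J.mem K.mem)

/-- The coproduct of two diagrams. -/
abbrev Dia.sum (J K : Dia 𝒟) : Dia 𝒟 := .mk (J ⊕ K) (IsDiagramCategory.sum J K J.mem K.mem)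

/-- The comma category `(k / u)` of pairs `(j, k ⟶ u j)`. -/
abbrev Dia.under {J K : Dia 𝒟} (u : J ⥤ K) (k : K) : Dia 𝒟 := .mk (StructuredArrow k u)
  (IsDiagramCategory.structuredArrow u k J.mem K.mem)

/-- The comma category `(u / k)` of pairs `(j, u j ⟶ k)`. -/
abbrev Dia.over {J K : Dia 𝒟} (u : J ⥤ K) (k : K) : Dia 𝒟 := .mk (CostructuredArrow u k)
  (IsDiagramCategory.costructuredArrow u k J.mem K.mem)

/-- The functor `J ⥤ e`. -/
abbrev Dia.toPt (J : Dia 𝒟) : J ⥤ Dia.pt 𝒟 := Functor.star J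

/-- The functor `e ⥤ J` with value `j`. -/
abbrev Dia.point {J : Dia 𝒟} (j : J) : Dia.pt 𝒟 ⥤ J := Functor.fromPUnit j

variable (𝒟)

/-- The square `□ = [1] × [1]`. -/
abbrev Dia.square : Dia 𝒟 := Dia.prod (Dia.interval 𝒟) (Dia.interval 𝒟)

/-- The objects of the square other than the initial vertex `(0, 0)`. -/
abbrev cornerProperty : ObjectProperty (Interval.{w} × Interval.{w}) := fun x => x ≠ (⟨0⟩, ⟨0⟩)

lemma mem_corner : 𝒟 (Cat.of cornerProperty.{w}.FullSubcategory) := by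
  have : Quiver.IsThin cornerProperty.{w}.FullSubcategory := fun x y =>
    ⟨fun f g => by
      apply ObjectProperty.hom_ext
      exact Prod.ext (Subsingleton.elim _ _) (Subsingleton.elim _ _)⟩
  have : Finite cornerProperty.{w}.FullSubcategory :=
    Finite.of_injective (fun x => x.obj) fun x y h => by
      cases x; cases y; cases h; rfl
  refine IsDiagramCategory.finite_poset _ ?_
  rintro ⟨x, hx⟩ ⟨y, hy⟩ ⟨e⟩
  have h₁ : x.1 = y.1 := le_antisymm e.hom.hom.1.le e.inv.hom.1.le
  have h₂ : x.2 = y.2 := le_antisymm e.hom.hom.2.le e.inv.hom.2.le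
  obtain rfl : x = y := Prod.ext h₁ h₂
  rfl

/-- The corner `⌟`: the full subcategory of the square on the objects other than `(0, 0)`. -/
abbrev Dia.corner : Dia 𝒟 := .mk cornerProperty.{w}.FullSubcategory (mem_corner 𝒟)

/-- The 2-functor `J ↦ J × [1]` of `Diaᵒᵖ`. -/
def timesInterval : Pseudofunctor (Dia 𝒟)ᵒᵖ (Dia 𝒟)ᵒᵖ where
  obj J := op (Dia.prod J.unop (Dia.interval 𝒟))
  map {J K} u := (Dia.hom (J := K.unop.prod (Dia.interval 𝒟)) (K := J.unop.prod (Dia.interval 𝒟))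
    (Functor.prod u.unop (𝟭 Interval.{w}))).op
  map₂ {J K u v} α := Bicategory.Opposite.op2 (Dia.hom₂ (J := K.unop.prod (Dia.interval 𝒟))
    (K := J.unop.prod (Dia.interval 𝒟)) (NatTrans.prod α.unop2 (𝟙 (𝟭 Interval.{w}))))
  mapId J := Iso.refl _
  mapComp u v := Iso.refl _
  map₂_id f := Dia.hom₂_op_ext fun x => rfl
  map₂_comp α β := Dia.hom₂_op_ext fun x => Prod.ext rfl (Category.id_comp _).symm
  map₂_whisker_left f g h α := Dia.hom₂_op_ext fun x => Prod.ext
    ((Category.id_comp _).trans (Category.comp_id _)).symm rfl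
  map₂_whisker_right α h := Dia.hom₂_op_ext fun x => Prod.ext
    ((Category.id_comp _).trans (Category.comp_id _)).symm rfl
  map₂_associator {a b c d} f g h := Dia.hom₂_op_ext fun x => Prod.ext (by
    have e {y : a.unop} {φ : y ⟶ y} (hφ : φ = 𝟙 y) : 𝟙 y = 𝟙 y ≫ 𝟙 y ≫ 𝟙 y ≫ φ ≫ 𝟙 y := by
      simp [hφ]
    exact e (CategoryTheory.Functor.map_id (show b.unop ⥤ a.unop from f.unop) _)) rfl
  map₂_left_unitor {a b} f := Dia.hom₂_op_ext fun x => Prod.ext (by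
    have e (y : a.unop) : 𝟙 y = 𝟙 y ≫ 𝟙 y ≫ 𝟙 y := by simp
    exact e _) rfl
  map₂_right_unitor {a b} f := Dia.hom₂_op_ext fun x => Prod.ext (by
    have e {y : a.unop} {φ : y ⟶ y} (hφ : φ = 𝟙 y) : 𝟙 y = 𝟙 y ≫ φ ≫ 𝟙 y := by
      simp [hφ]
    exact e (CategoryTheory.Functor.map_id (show b.unop ⥤ a.unop from f.unop) _)) rfl

instance : Bicategory.Strict (Dia 𝒟)ᵒᵖ where

variable {𝒟}
namespace Prederivator
variable (D : Prederivator.{w, v, u} 𝒟)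
/-- The shifted prederivator `D^[1]`, with `D^[1](J) = D(J × [1])`. -/
def arrow : Prederivator.{w, v, u} 𝒟 := (timesInterval 𝒟).comp D

/-- The inclusion `J ⥤ J × [1]`, `j ↦ (j, i)`, as a 1-cell of `Diaᵒᵖ`. -/
abbrev incl (J : (Dia 𝒟)ᵒᵖ) (i : Interval.{w}) : (timesInterval 𝒟).obj J ⟶ J :=
  (Dia.hom (J := J.unop) (K := J.unop.prod (Dia.interval 𝒟)) (Prod.sectL J.unop i)).op

/-- The evaluation morphism `i^* : D^[1] ⟶ D`, for `i = 0, 1`. -/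
def eval (i : Interval.{w}) : D.arrow ⟶ D where
  app J := D.map (incl J i)
  naturality {J K} u := (D.mapComp' ((timesInterval 𝒟).map u) (incl K i) (incl J i ≫ u) rfl).symm ≪≫
    D.mapComp' (incl J i) u (incl J i ≫ u) rfl
  naturality_naturality {J K u u'} α :=
    isoMap_nat D (incl J i) (incl K i) (incl J i ≫ u) (incl J i ≫ u') rfl rfl rfl rfl α
      ((timesInterval 𝒟).map₂ α) (incl J i ◁ α)
      (eq_conj_eqToHom_refl _)
      (eq_conj_eqToHom_refl _)
  naturality_id J := by
    have h : (D.arrow.mapId J).hom = (D.mapId ((timesInterval 𝒟).obj J)).hom := by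
      change D.map₂ (𝟙 _) ≫ _ = _
      rw [D.map₂_id]
      exact Category.id_comp _
    rw [h]
    exact isoMap_id D (incl J i)
  naturality_comp {a b c} f g := by
    have h : (D.arrow.mapComp f g).hom =
        (D.mapComp ((timesInterval 𝒟).map f) ((timesInterval 𝒟).map g)).hom := by
      change D.map₂ (𝟙 _) ≫ _ = _
      rw [D.map₂_id]
      exact Category.id_comp _
    rw [h]
    exact isoMap_comp D f g ((timesInterval 𝒟).map f) ((timesInterval 𝒟).map g)
      (incl a i) (incl b i) (incl c i) (incl a i ≫ f) (incl b i ≫ g) (incl a i ≫ f ≫ g)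
      rfl rfl rfl rfl rfl rfl

/-- The morphism `X_0 ⟶ X_1` of `D(J)` underlying a coherent arrow `X` in `D(J × [1])`. -/
def dia {J : Dia 𝒟} (X : D.cat (J.prod (Dia.interval 𝒟))) :
    (D.pull (K := J.prod (Dia.interval 𝒟)) (Prod.sectL J (⟨0⟩ : Interval.{w}))).obj X ⟶
      (D.pull (K := J.prod (Dia.interval 𝒟)) (Prod.sectL J (⟨1⟩ : Interval.{w}))).obj X :=
  (D.pullMap (K := J.prod (Dia.interval 𝒟))
    (intervalCell J)).app X

/-- Existence of left and right Kan extensions: every `u^*` has a left adjoint `u_!` and a right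
adjoint `u_*`. -/
class HasKanExtensions : Prop where
  isRightAdjoint {J K : Dia 𝒟} (u : J ⥤ K) : (D.pull u).IsRightAdjoint
  isLeftAdjoint {J K : Dia 𝒟} (u : J ⥤ K) : (D.pull u).IsLeftAdjoint

attribute [instance] HasKanExtensions.isRightAdjoint HasKanExtensions.isLeftAdjoint

section Kan
variable [D.HasKanExtensions] {J K : Dia 𝒟} (u : J ⥤ K)

/-- The left Kan extension functor `u_!`. -/
noncomputable def lan : D.cat J ⥤ D.cat K := (D.pull u).leftAdjoint

/-- The right Kan extension functor `u_*`. -/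
noncomputable def ran : D.cat J ⥤ D.cat K := (D.pull u).rightAdjoint

/-- The adjunction `u_! ⊣ u^*`. -/
noncomputable def lanAdj : D.lan u ⊣ D.pull u := Adjunction.ofIsRightAdjoint (D.pull u)

/-- The adjunction `u^* ⊣ u_*`. -/
noncomputable def ranAdj : D.pull u ⊣ D.ran u := Adjunction.ofIsLeftAdjoint (D.pull u)

/-- The canonical mate `k^* u_* Y ⟶ pt_* pr^* Y` of the comma square of `k` and `u`. -/
noncomputable def ranMate (k : K) (Y : D.cat J) :
    (D.pull (Dia.point k)).obj ((D.ran u).obj Y) ⟶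
      (D.ran (Dia.under u k).toPt).obj
        ((D.pull (J := Dia.under u k) (StructuredArrow.proj k u)).obj Y) :=
  (D.ranAdj (Dia.under u k).toPt).homEquiv _ _
    ((D.pullComp (Dia.under u k).toPt (Dia.point k)).inv.app _ ≫
      (D.pullMap (J := Dia.under u k) (underCell u k)).app _ ≫
      (D.pullComp (J := Dia.under u k) (StructuredArrow.proj k u) u).hom.app _ ≫
      (D.pull (J := Dia.under u k) (StructuredArrow.proj k u)).map ((D.ranAdj u).counit.app Y))

/-- The canonical mate `pt_! pr^* Y ⟶ k^* u_! Y` of the comma square of `u` and `k`. -/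
noncomputable def lanMate (k : K) (Y : D.cat J) :
    (D.lan (Dia.over u k).toPt).obj
        ((D.pull (J := Dia.over u k) (CostructuredArrow.proj u k)).obj Y) ⟶
      (D.pull (Dia.point k)).obj ((D.lan u).obj Y) :=
  ((D.lanAdj (Dia.over u k).toPt).homEquiv _ _).symm
    ((D.pull (J := Dia.over u k) (CostructuredArrow.proj u k)).map ((D.lanAdj u).unit.app Y) ≫
      (D.pullComp (J := Dia.over u k) (CostructuredArrow.proj u k) u).inv.app _ ≫
      (D.pullMap (J := Dia.over u k) (overCell u k)).app _ ≫
      (D.pullComp (Dia.over u k).toPt (Dia.point k)).hom.app _)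

end Kan

/-- A derivator: a prederivator which sends finite coproducts to products, for which isomorphisms
are detected pointwise, and in which Kan extensions exist and are computed pointwise. -/
class IsDerivator : Prop extends D.HasKanExtensions where
  empty (J : Dia 𝒟) [IsEmpty J] : (Functor.star.{w} (D.cat J)).IsEquivalence
  sum (J K : Dia 𝒟) : ((D.pull (K := J.sum K) (Sum.inl_ J K)).prod'
    (D.pull (K := J.sum K) (Sum.inr_ J K))).IsEquivalence
  isIso_of_pointwise {J : Dia 𝒟} {X Y : D.cat J} (f : X ⟶ Y) :
    (∀ j : J, IsIso ((D.pull (Dia.point j)).map f)) → IsIso f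
  isIso_ranMate {J K : Dia 𝒟} (u : J ⥤ K) (k : K) (Y : D.cat J) : IsIso (D.ranMate u k Y)
  isIso_lanMate {J K : Dia 𝒟} (u : J ⥤ K) (k : K) (Y : D.cat J) : IsIso (D.lanMate u k Y)

/-- A coherent square `X` is cartesian if the unit `X ⟶ i_* i^* X` is invertible, where `i` is the
inclusion of the corner in the square. -/
def IsCartesian [D.HasKanExtensions] (X : D.cat (Dia.square 𝒟)) : Prop :=
  IsIso ((D.ranAdj (J := Dia.corner 𝒟) (K := Dia.square 𝒟) cornerProperty.{w}.ι).unit.app X)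

/-- The vertical edge `X_(0,c) ⟶ X_(1,c)` of a coherent square, as an object of `D^[1](e)`. -/
def edge (c : Interval.{w}) (X : D.cat (Dia.square 𝒟)) : D.arrow.cat (Dia.pt 𝒟) :=
  (D.pull (J := (Dia.pt 𝒟).prod (Dia.interval 𝒟)) (K := Dia.square 𝒟)
    (CategoryTheory.Prod.snd _ _ ⋙ Prod.sectL Interval.{w} c)).obj X

variable {D E : Prederivator.{w, v, u} 𝒟}

section Preservation
variable [D.HasKanExtensions] [E.HasKanExtensions] (L : D ⟶ E)

/-- The canonical mate `L (u_* Y) ⟶ u_* (L Y)`. -/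
noncomputable def ranComparison {A B : Dia 𝒟} (u : A ⥤ B) (Y : D.cat A) :
    (L.app (op B)).toFunctor.obj ((D.ran u).obj Y) ⟶
      (E.ran u).obj ((L.app (op A)).toFunctor.obj Y) :=
  (E.ranAdj u).homEquiv _ _
    ((L.naturality (Dia.hom u).op).inv.toNatTrans.app ((D.ran u).obj Y) ≫
      (L.app (op A)).toFunctor.map ((D.ranAdj u).counit.app Y))

/-- `L` commutes with right Kan extensions along `u`. -/
def CommutesWithRan {A B : Dia 𝒟} (u : A ⥤ B) : Prop :=
  ∀ Y : D.cat A, IsIso (ranComparison L u Y)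

end Preservation

end Prederivator

/-- A finite category in the homotopical sense: finitely many objects and arrows, and no
endomorphism besides the identities (so that the nerve of a skeleton has finitely many
nondegenerate simplices). -/
structure IsFiniteCategory (J : Type w) [SmallCategory J] : Prop where
  finite_obj : Finite J
  finite_hom (x y : J) : Finite (x ⟶ y)
  endo_eq_id (x : J) (f : x ⟶ x) : f = 𝟙 x

open Prederivator

variable {D E : Prederivator.{w, v, u} 𝒟}

/-- `L` commutes with finite limits, a limit being a right Kan extension along `A ⥤ e`. -/
def CommutesWithFiniteLimits [D.HasKanExtensions] [E.HasKanExtensions] (L : D ⟶ E) : Prop :=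
  ∀ A : Dia 𝒟, IsFiniteCategory A → CommutesWithRan L A.toPt

/-- `L` is left exact: it commutes with right Kan extensions along functors between finite
categories. -/
def IsLeftExact [D.HasKanExtensions] [E.HasKanExtensions] (L : D ⟶ E) : Prop :=
  ∀ (A B : Dia 𝒟) (u : A ⥤ B), IsFiniteCategory A → IsFiniteCategory B → CommutesWithRan L u

/-- The sub-prederivator `S_L` of `D^[1]`: the coherent arrows `X` such that the arrow underlying
`L X` is an isomorphism. -/
def locals (L : D ⟶ E) : Pseudofunctor.ObjectProperty D.arrow where
  prop J X := IsIso (E.dia (J := J.unop)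
    ((L.app (op (J.unop.prod (Dia.interval 𝒟)))).toFunctor.obj X))

/-- `S_L` is stable under homotopy pullback. -/
def LocalsPullbackStable [D.HasKanExtensions] (L : D ⟶ E) : Prop :=
  ∀ X : D.cat (Dia.square 𝒟), D.IsCartesian X →
    (locals L).prop (op (Dia.pt 𝒟)) (D.edge ⟨1⟩ X) →
      (locals L).prop (op (Dia.pt 𝒟)) (D.edge ⟨0⟩ X)

/-- `S_L` is closed under right Kan extensions in `D^[1]`, that is right Kan extensions along
`u × [1]` in `D`, for `u` a functor between finite categories. -/
def LocalsClosedUnderFiniteRan [D.HasKanExtensions] (L : D ⟶ E) : Prop :=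
  ∀ (A B : Dia 𝒟) (u : A ⥤ B), IsFiniteCategory A → IsFiniteCategory B →
    ∀ X : D.cat (A.prod (Dia.interval 𝒟)), (locals L).prop (op A) X →
      (locals L).prop (op B) ((D.ran (J := A.prod (Dia.interval 𝒟))
        (K := B.prod (Dia.interval 𝒟)) (u.prod (𝟭 Interval.{w}))).obj X)

/-- The sub-prederivator `Chr` of `D^[1]` of the coherent arrows `X` such that `X_1` lies in the
essential image of `R`. -/
def chr (R : E ⟶ D) : Pseudofunctor.ObjectProperty D.arrow where
  prop J X := (R.app J).toFunctor.essImage (((D.eval ⟨1⟩).app J).toFunctor.obj X)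

instance (R : E ⟶ D) : (chr R).IsClosedUnderMapObj where
  map_obj {J K X} := by
    rintro ⟨Y, ⟨e⟩⟩ u
    refine ⟨(E.map u).toFunctor.obj Y, ⟨?_⟩⟩
    exact (Cat.Hom.toNatIso (R.naturality u)).app Y ≪≫ (D.map u).toFunctor.mapIso e ≪≫
      ((Cat.Hom.toNatIso ((D.eval ⟨1⟩).naturality u)).app X).symm

/-- The morphism `R♯ : Chr ⟶ D`, the restriction of the evaluation at `0`. -/
def sharp (R : E ⟶ D) : (chr R).fullsubcategory ⟶ D :=
  (show (chr R).fullsubcategory ⟶ D.arrow from (chr R).ι) ≫ D.eval ⟨0⟩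

/-- An adjunction `L ⊣ R` of prederivators is a reflection if `R` is fully faithful, i.e. if the
counit is invertible. -/
def IsReflection {L : D ⟶ E} {R : E ⟶ D} (adj : Bicategory.Adjunction L R) : Prop :=
  IsIso adj.counit

/-- A choric reflection: a reflection for which `R♯` has a left adjoint in the 2-category of
prederivators. -/
structure IsChoricReflection {L : D ⟶ E} {R : E ⟶ D} (adj : Bicategory.Adjunction L R) : Prop where
  isReflection : IsReflection adj
  isRightAdjoint_sharp : Bicategory.IsRightAdjoint (sharp R)

end Shapes

end Derivators

/-!
The proof works with right Kan extensions through their universal property: `IsRan u t` says that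
`t : u^* Z ⟶ Y` exhibits `Z` as `u_* Y`. In a derivator this property can be tested pointwise, with
each comma category replaced by any category that maps to it by a left adjoint
(`isRan_of_pointwise`, `IsRan.baseChange`). A morphism `L` commutes with right Kan extensions along
`u` when it preserves the cones `t` with `IsRan u t`, so commuting with finite limits implies left
exactness.

Restriction along the projection `J × [1] ⥤ J` is right Kan extension along the inclusion at `1`,
and a coherent arrow has an invertible underlying arrow exactly when it lies in the essential image
of this restriction. Hence such coherent arrows are closed under right Kan extensions along
`u × [1]` (`IsRan.isIso_dia`), and for a left exact `L` the coherent arrows in `S_L` are closed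
under finite right Kan extensions. A cartesian square, viewed as a coherent arrow between its rows,
is a right Kan extension in `D^[1]` of its restriction to the corner; this gives pullback stability
of `S_L`.

For the way back from pullback stability to finite limits, the choric hypothesis provides for every
coherent diagram `Y` a coherent arrow with source `Y` and local target which is inverted by `L`
(`exists_resolution`). Limits of local diagrams are preserved by the reflection, so `L` commutes
with limits over `A` as soon as it inverts the comparison between the limits of the two ends of any
coherent arrow in `S_L(A)`.

Let `P` be a finite poset. Extend such an arrow `C`, a diagram on `P × [1]`, to the poset of
cosieves of `P × [1]`: the value at a cosieve is the limit over it, and the values at `U ∪ V`, `U`,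
`V` and `U ∩ V` form a cartesian square (`IsRan.isCartesian_square`). The limits of the two ends are
the values at `P × [1]` and at `P × {1}`, and one passes from the first to the second by removing
the objects of `P × {0}` one by one, a minimal one first. By pullback stability, the comparison for
the removal of `(a, 0)` is inverted if the one from the value at `(a, 0)` to the limit over the
objects strictly above it is; the latter follows by two out of three from the arrow
`C(a, 0) ⟶ C(a, 1)` and induction (`LocalsPullbackStable.inverts_cylinder`).

A finite category `A` without endomorphisms other than identities is finally reduced to a finite
poset. The stars `(r, S)`, where `r` runs through a skeleton and `S` is a set of arrows out of `r`
with distinct targets which contains the identity, form a finite poset with a functor `(r, S) ↦ r`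
to `A`, and every coherent diagram on `A` is the right Kan extension of its restriction along this
functor (`isRan_rootFunctor`).
-/

namespace Derivators

variable {𝒟 : ObjectProperty Cat.{w, w}}

namespace Prederivator

/-! ### Restriction functors of a prederivator -/

section Pull
variable (D : Prederivator.{w, v, u} 𝒟) {J K M N : Dia 𝒟}

lemma pullMap_id (f : J ⥤ K) : D.pullMap (𝟙 f) = 𝟙 (D.pull f) :=
  congrArg Cat.Hom₂.toNatTrans (D.map₂_id (Dia.hom f).op)

lemma pullMap_comp {f g h : J ⥤ K} (α : f ⟶ g) (β : g ⟶ h) :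
    D.pullMap (α ≫ β) = D.pullMap α ≫ D.pullMap β :=
  congrArg Cat.Hom₂.toNatTrans (D.map₂_comp (Bicategory.Opposite.op2 (Dia.hom₂ α))
    (Bicategory.Opposite.op2 (Dia.hom₂ β)))

lemma pullMap_app_comp {f g h : J ⥤ K} (α : f ⟶ g) (β : g ⟶ h) (Z : D.cat K) :
    (D.pullMap (α ≫ β)).app Z = (D.pullMap α).app Z ≫ (D.pullMap β).app Z := by
  rw [pullMap_comp]; rfl

/-- Restriction along the identity functor is the identity. -/
abbrev pullId (J : Dia 𝒟) : D.pull (𝟭 J) ≅ 𝟭 (D.cat J) :=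
  Cat.Hom.toNatIso (D.mapId (op J))

lemma pullMap_whiskerRight {f g : J ⥤ K} (α : f ⟶ g) (h : K ⥤ M) (Z : D.cat M) :
    (D.pullMap (Functor.whiskerRight α h)).app Z ≫ (D.pullComp g h).hom.app Z =
      (D.pullComp f h).hom.app Z ≫ (D.pullMap α).app ((D.pull h).obj Z) := by
  have := congr($(D.map₂_whisker_left (Dia.hom h).op
    (Bicategory.Opposite.op2 (Dia.hom₂ α))).toNatTrans.app Z)
  have h2 : (D.pullMap (Functor.whiskerRight α h)).app Z =
    (D.pullComp f h).hom.app Z ≫ (D.pullMap α).app ((D.pull h).obj Z) ≫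
      (D.pullComp g h).inv.app Z := this
  rw [h2, Category.assoc, Category.assoc, Iso.inv_hom_id_app]
  exact congrArg _ (Category.comp_id _)

lemma pullMap_whiskerLeft (f : J ⥤ K) {g h : K ⥤ M} (β : g ⟶ h) (Z : D.cat M) :
    (D.pullMap (Functor.whiskerLeft f β)).app Z ≫ (D.pullComp f h).hom.app Z =
      (D.pullComp f g).hom.app Z ≫ (D.pull f).map ((D.pullMap β).app Z) := by
  have := congr($(D.map₂_whisker_right (Bicategory.Opposite.op2 (Dia.hom₂ β))
    (Dia.hom f).op).toNatTrans.app Z)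
  have h2 : (D.pullMap (Functor.whiskerLeft f β)).app Z =
    (D.pullComp f g).hom.app Z ≫ (D.pull f).map ((D.pullMap β).app Z) ≫
      (D.pullComp f h).inv.app Z := this
  rw [h2, Category.assoc, Category.assoc, Iso.inv_hom_id_app]
  exact congrArg _ (Category.comp_id _)

lemma pullComp_assoc (f : J ⥤ K) (g : K ⥤ M) (h : M ⥤ N) (Z : D.cat N) :
    (D.pullComp (f ⋙ g) h).hom.app Z ≫ (D.pullComp f g).hom.app ((D.pull h).obj Z) =
      (D.pullComp f (g ⋙ h)).hom.app Z ≫ (D.pull f).map ((D.pullComp g h).hom.app Z) := by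
  have h1 : (D.pullComp f (g ⋙ h)).hom.app Z ≫ (D.pull f).map ((D.pullComp g h).hom.app Z) =
      (D.pullMap (𝟙 (f ⋙ g ⋙ h))).app Z ≫ (D.pullComp (f ⋙ g) h).hom.app Z ≫
        (D.pullComp f g).hom.app ((D.pull h).obj Z) ≫ 𝟙 _ :=
    congr($(D.mapComp_assoc_left_hom (Dia.hom h).op (Dia.hom g).op
      (Dia.hom f).op).toNatTrans.app Z)
  rw [h1, pullMap_id, Category.comp_id]
  exact (Category.id_comp _).symm

lemma pullComp_id_left (f : J ⥤ K) (Z : D.cat K) :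
    (D.pullComp (𝟭 J) f).hom.app Z = (D.pullId J).inv.app ((D.pull f).obj Z) := by
  have h1 : (D.pullComp (𝟭 J) f).hom.app Z = (D.pullMap (𝟙 f)).app Z ≫ 𝟙 _ ≫
      (D.pullId J).inv.app ((D.pull f).obj Z) :=
    congr($(D.mapComp_id_right_hom (Dia.hom f).op).toNatTrans.app Z)
  rw [h1, pullMap_id, Category.id_comp]
  exact Category.id_comp _

lemma pullComp_id_right (f : J ⥤ K) (Z : D.cat K) :
    (D.pullComp f (𝟭 K)).hom.app Z = (D.pull f).map ((D.pullId K).inv.app Z) := by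
  have h1 : (D.pullComp f (𝟭 K)).hom.app Z = (D.pullMap (𝟙 f)).app Z ≫ 𝟙 _ ≫
      (D.pull f).map ((D.pullId K).inv.app Z) :=
    congr($(D.mapComp_id_left_hom (Dia.hom f).op).toNatTrans.app Z)
  rw [h1, pullMap_id, Category.id_comp]
  exact Category.id_comp _

lemma pullComp_inv_whiskerRight {f g : J ⥤ K} (α : f ⟶ g) (h : K ⥤ M) (Z : D.cat M) :
    (D.pullComp f h).inv.app Z ≫ (D.pullMap (Functor.whiskerRight α h)).app Z =
      (D.pullMap α).app ((D.pull h).obj Z) ≫ (D.pullComp g h).inv.app Z := by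
  rw [← cancel_mono ((D.pullComp g h).hom.app Z), Category.assoc, D.pullMap_whiskerRight,
    Iso.inv_hom_id_app_assoc, Category.assoc, Iso.inv_hom_id_app]
  exact (Category.comp_id _).symm

lemma pullComp_inv_whiskerLeft (f : J ⥤ K) {g h : K ⥤ M} (β : g ⟶ h) (Z : D.cat M) :
    (D.pullComp f g).inv.app Z ≫ (D.pullMap (Functor.whiskerLeft f β)).app Z =
      (D.pull f).map ((D.pullMap β).app Z) ≫ (D.pullComp f h).inv.app Z := by
  rw [← cancel_mono ((D.pullComp f h).hom.app Z), Category.assoc, D.pullMap_whiskerLeft,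
    Iso.inv_hom_id_app_assoc, Category.assoc, Iso.inv_hom_id_app]
  exact (Category.comp_id _).symm

lemma pullComp_assoc_inv (f : J ⥤ K) (g : K ⥤ M) (h : M ⥤ N) (Z : D.cat N) :
    (D.pull f).map ((D.pullComp g h).hom.app Z) ≫ (D.pullComp f g).inv.app ((D.pull h).obj Z) =
      (D.pullComp f (g ⋙ h)).inv.app Z ≫ (D.pullComp (f ⋙ g) h).hom.app Z := by
  rw [← cancel_mono ((D.pullComp f g).hom.app ((D.pull h).obj Z)), Category.assoc,
    Iso.inv_hom_id_app, Category.assoc, D.pullComp_assoc, Iso.inv_hom_id_app_assoc]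
  exact Category.comp_id _

lemma pullComp_assoc_inv' (f : J ⥤ K) (g : K ⥤ M) (h : M ⥤ N) (Z : D.cat N) :
    (D.pullComp f g).hom.app ((D.pull h).obj Z) ≫ (D.pull f).map ((D.pullComp g h).inv.app Z) =
      (D.pullComp (f ⋙ g) h).inv.app Z ≫ (D.pullComp f (g ⋙ h)).hom.app Z := by
  rw [← cancel_mono ((D.pull f).map ((D.pullComp g h).hom.app Z)), Category.assoc,
    ← Functor.map_comp, Iso.inv_hom_id_app, Category.assoc, ← D.pullComp_assoc,
    Iso.inv_hom_id_app_assoc]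
  erw [CategoryTheory.Functor.map_id]
  exact Category.comp_id _

/-- Restriction reverses adjunctions of functors: `f ⊣ g` gives `g^* ⊣ f^*`. -/
def pullAdj {f : J ⥤ K} {g : K ⥤ J} (adj : f ⊣ g) : D.pull g ⊣ D.pull f :=
  Adjunction.mkOfUnitCounit
    { unit := (D.pullId J).inv ≫ D.pullMap adj.unit ≫ (D.pullComp f g).hom
      counit := (D.pullComp g f).inv ≫ D.pullMap adj.counit ≫ (D.pullId K).hom
      left_triangle := by
        ext X
        have h : Functor.whiskerLeft g adj.unit ≫ Functor.whiskerRight adj.counit g = 𝟙 g := by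
          ext; simp
        have h' := congrArg (fun a => (D.pullMap a).app X) h
        rw [D.pullMap_app_comp, D.pullMap_id] at h'
        change (D.pull g).map ((D.pullId J).inv.app X ≫ (D.pullMap adj.unit).app X ≫
          (D.pullComp f g).hom.app X) ≫ 𝟙 _ ≫ (D.pullComp g f).inv.app ((D.pull g).obj X) ≫
          (D.pullMap adj.counit).app _ ≫ (D.pullId K).hom.app _ = 𝟙 _
        rw [Category.id_comp, Functor.map_comp, Functor.map_comp, Category.assoc, Category.assoc,
          reassoc_of% D.pullComp_assoc_inv]
        erw [← reassoc_of% D.pullMap_whiskerRight, ← reassoc_of% D.pullComp_inv_whiskerLeft]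
        erw [reassoc_of% h', D.pullComp_id_left, Iso.inv_hom_id_app]
        erw [Category.comp_id, ← Category.assoc, ← D.pullComp_id_right, Iso.hom_inv_id_app]
        exact Category.id_comp _
      right_triangle := by
        ext X
        have h : Functor.whiskerRight adj.unit f ≫ Functor.whiskerLeft f adj.counit = 𝟙 f := by
          ext; simp
        have h' := congrArg (fun a => (D.pullMap a).app X) h
        rw [D.pullMap_app_comp, D.pullMap_id] at h'
        change ((D.pullId J).inv.app ((D.pull f).obj X) ≫ (D.pullMap adj.unit).app _ ≫
          (D.pullComp f g).hom.app _) ≫ 𝟙 _ ≫ (D.pull f).map ((D.pullComp g f).inv.app X ≫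
          (D.pullMap adj.counit).app _ ≫ (D.pullId K).hom.app _) = 𝟙 _
        rw [Category.id_comp, Functor.map_comp, Functor.map_comp, Category.assoc, Category.assoc]
        erw [reassoc_of% D.pullComp_assoc_inv']
        erw [← reassoc_of% D.pullMap_whiskerLeft, ← reassoc_of% D.pullComp_inv_whiskerRight]
        erw [reassoc_of% h']
        erw [Category.id_comp, D.pullComp_id_right, ← Functor.map_comp, Iso.inv_hom_id_app,
          CategoryTheory.Functor.map_id, Category.comp_id]
        rw [← D.pullComp_id_left, Iso.hom_inv_id_app]
        rfl }

end Pull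

/-! ### Right Kan extensions by their universal property -/

section Ran
variable {D : Prederivator.{w, v, u} 𝒟} {A B C : Dia 𝒟}

/-- A morphism `t : u^* Z ⟶ Y` exhibits `Z` as the right Kan extension of `Y` along `u` if it is
universal from `u^*` to `Y`. -/
def IsRan (u : A ⥤ B) {Z : D.cat B} {Y : D.cat A} (t : (D.pull u).obj Z ⟶ Y) : Prop :=
  ∀ W : D.cat B, Function.Bijective fun ψ : W ⟶ Z => (D.pull u).map ψ ≫ t

variable {u : A ⥤ B} {Z Z' : D.cat B} {Y Y' : D.cat A} {t : (D.pull u).obj Z ⟶ Y}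
  {t' : (D.pull u).obj Z' ⟶ Y'}

lemma isRan_iff_isIso_homEquiv {G : D.cat A ⥤ D.cat B} (adj : D.pull u ⊣ G)
    (t : (D.pull u).obj Z ⟶ Y) : IsRan u t ↔ IsIso (adj.homEquiv _ _ t) := by
  rw [isIso_iff_yoneda_map_bijective]
  refine forall_congr' fun W => ?_
  rw [← (adj.homEquiv W Y).comp_bijective]
  refine iff_of_eq (congrArg _ (funext fun ψ => ?_))
  exact adj.homEquiv_naturality_left ψ t

lemma isRan_counit {G : D.cat A ⥤ D.cat B} (adj : D.pull u ⊣ G) (Y : D.cat A) :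
    IsRan u (adj.counit.app Y) := by
  rw [isRan_iff_isIso_homEquiv adj]
  simp only [Adjunction.homEquiv_unit, Adjunction.right_triangle_components]
  infer_instance

variable (D) in
/-- The counit of the adjunction `u^* ⊣ u_*`. -/
noncomputable def ranCounit [D.HasKanExtensions] (u : A ⥤ B) (Y : D.cat A) :
    (D.pull u).obj ((D.ran u).obj Y) ⟶ Y := (D.ranAdj u).counit.app Y

variable (D) in
lemma isRan_ranCounit [D.HasKanExtensions] (u : A ⥤ B) (Y : D.cat A) :
    IsRan u (D.ranCounit u Y) := isRan_counit _ _

lemma IsRan.hom_ext (h : IsRan u t) {W : D.cat B} {a b : W ⟶ Z}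
    (e : (D.pull u).map a ≫ t = (D.pull u).map b ≫ t) : a = b := (h W).1 e

lemma IsRan.exists_lift (h : IsRan u t) {W : D.cat B} (φ : (D.pull u).obj W ⟶ Y) :
    ∃ a : W ⟶ Z, (D.pull u).map a ≫ t = φ := (h W).2 φ

/-- A morphism between right Kan extensions of isomorphic objects is invertible. -/
lemma IsRan.isIso (h : IsRan u t) (h' : IsRan u t') (a : Z ⟶ Z') (b : Y ⟶ Y') [IsIso b]
    (e : (D.pull u).map a ≫ t' = t ≫ b) : IsIso a := by
  obtain ⟨c, hc⟩ := h.exists_lift (t' ≫ inv b)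
  refine ⟨c, h.hom_ext ?_, h'.hom_ext ?_⟩
  · rw [Functor.map_comp, Category.assoc, hc, reassoc_of% e, IsIso.hom_inv_id,
      CategoryTheory.Functor.map_id, Category.comp_id, Category.id_comp]
  · rw [Functor.map_comp, Category.assoc, e, reassoc_of% hc, IsIso.inv_hom_id,
      CategoryTheory.Functor.map_id, Category.comp_id, Category.id_comp]

lemma IsRan.isIso' (h : IsRan u t) {t₁ : (D.pull u).obj Z' ⟶ Y} (h' : IsRan u t₁) (a : Z ⟶ Z')
    (e : (D.pull u).map a ≫ t₁ = t) : IsIso a :=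
  h.isIso h' a (𝟙 Y) (by rw [e, Category.comp_id])

lemma IsRan.nonempty_iso (h : IsRan u t) {t₁ : (D.pull u).obj Z' ⟶ Y} (h' : IsRan u t₁) :
    Nonempty (Z ≅ Z') := by
  obtain ⟨c, hc⟩ := h'.exists_lift t
  have := h.isIso' h' c hc
  exact ⟨asIso c⟩

lemma IsRan.comp_iso_iff (b : Y ⟶ Y') [IsIso b] : IsRan u (t ≫ b) ↔ IsRan u t := by
  refine forall_congr' fun W => ?_
  rw [← ((asIso b).homToEquiv (Z := (D.pull u).obj W)).comp_bijective]
  refine iff_of_eq (congrArg _ (funext fun ψ => ?_))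
  simp

lemma IsRan.iso_comp_iff (a : Z' ⟶ Z) [IsIso a] : IsRan u ((D.pull u).map a ≫ t) ↔ IsRan u t := by
  refine forall_congr' fun W => ?_
  rw [← ((asIso a).homToEquiv (Z := W)).bijective_comp]
  refine iff_of_eq (congrArg _ (funext fun ψ => ?_))
  simp

/-- Being a right Kan extension is invariant under isomorphisms of the whole cone. -/
lemma IsRan.iff_of_isIso (a : Z ⟶ Z') (b : Y ⟶ Y') [IsIso a] [IsIso b]
    (e : (D.pull u).map a ≫ t' = t ≫ b) : IsRan u t ↔ IsRan u t' := by
  rw [← IsRan.iso_comp_iff (t := t') a, e, IsRan.comp_iso_iff]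

lemma isIso_pullMap_app {u u' : A ⥤ B} (α : u' ⟶ u) [IsIso α] (Z : D.cat B) :
    IsIso ((D.pullMap α).app Z) := by
  refine ⟨(D.pullMap (inv α)).app Z, ?_, ?_⟩ <;>
    rw [← pullMap_app_comp] <;> simp only [IsIso.hom_inv_id, IsIso.inv_hom_id, pullMap_id] <;> rfl

lemma IsRan.cell_iff {u' : A ⥤ B} (α : u' ⟶ u) [IsIso α] :
    IsRan u' ((D.pullMap α).app Z ≫ t) ↔ IsRan u t := by
  refine forall_congr' fun W => ?_
  have := isIso_pullMap_app α W
  rw [← ((asIso ((D.pullMap α).app W)).symm.homFromEquiv (Z := Y)).comp_bijective]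
  refine iff_of_eq (congrArg _ (funext fun ψ => ?_))
  simp

lemma isRan_id (e : (D.pull (𝟭 A)).obj Y ⟶ Y') [IsIso e] : IsRan (𝟭 A) e := by
  intro W
  have h : (fun ψ : W ⟶ Y => (D.pull (𝟭 A)).map ψ ≫ e) =
      (asIso ((D.pullId A).inv.app Y ≫ e)).homToEquiv.trans
        (((D.pullId A).app W).symm.homFromEquiv) := by
    funext ψ
    have h1 := (D.pullId A).hom.naturality ψ
    simp only [Equiv.trans_apply, Iso.homToEquiv_apply, Iso.homFromEquiv_apply, asIso_hom]
    erw [← reassoc_of% h1, Iso.hom_inv_id_app_assoc]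
  rw [h]
  exact Equiv.bijective _

/-- The composite of `t : u^* Z ⟶ Y` and `s : v^* V ⟶ Z`, lying over `u ⋙ v`. -/
abbrev paste {v : B ⥤ C} {V : D.cat C} (t : (D.pull u).obj Z ⟶ Y) (s : (D.pull v).obj V ⟶ Z) :
    (D.pull (u ⋙ v)).obj V ⟶ Y :=
  (D.pullComp u v).hom.app V ≫ (D.pull u).map s ≫ t

/-- Right Kan extensions compose and cancel. -/
lemma IsRan.paste_iff (h : IsRan u t) {v : B ⥤ C} {V : D.cat C} {s : (D.pull v).obj V ⟶ Z} :
    IsRan (u ⋙ v) (paste t s) ↔ IsRan v s := by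
  refine forall_congr' fun W => ?_
  rw [← (h _).of_comp_iff' (fun ψ : W ⟶ V => (D.pull v).map ψ ≫ s),
    ← (((D.pullComp u v).app W).symm.homFromEquiv (Z := Y)).comp_bijective]
  refine iff_of_eq (congrArg _ (funext fun ψ => ?_))
  have h1 := (D.pullComp u v).hom.naturality ψ
  simp only [Function.comp_apply, Iso.homFromEquiv_apply, Functor.map_comp, Category.assoc]
  erw [reassoc_of% h1]
  rfl

/-- Restriction along a left adjoint is right Kan extension along its right adjoint. -/
lemma isRan_pullAdj {f : A ⥤ B} {g : B ⥤ A} (adj : f ⊣ g) (Y : D.cat B) :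
    IsRan g ((D.pullAdj adj).counit.app Y) := isRan_counit _ _

end Ran

section Cone
variable {D : Prederivator.{w, v, u} 𝒟} {A B M N P : Dia 𝒟}
variable {u : A ⥤ B} {Z Z' : D.cat B} {Y Y' : D.cat A}

/-- The restriction along `F` of a morphism `t : v^* V ⟶ Z`, lying over `F ⋙ v`. -/
abbrev restr (F : N ⥤ M) {v : M ⥤ P} {V : D.cat P} {Z : D.cat M} (t : (D.pull v).obj V ⟶ Z) :
    (D.pull (F ⋙ v)).obj V ⟶ (D.pull F).obj Z :=
  (D.pullComp F v).hom.app V ≫ (D.pull F).map t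

/-- The base change of `t : u^* Z ⟶ Y` along a square `α : q ⋙ κ ⟶ m ⋙ u`. -/
abbrev baseChange {q : M ⥤ P} {κ : P ⥤ B} {m : M ⥤ A} (α : q ⋙ κ ⟶ m ⋙ u)
    (t : (D.pull u).obj Z ⟶ Y) : (D.pull q).obj ((D.pull κ).obj Z) ⟶ (D.pull m).obj Y :=
  (D.pullComp q κ).inv.app Z ≫ (D.pullMap α).app Z ≫ (D.pullComp m u).hom.app Z ≫
    (D.pull m).map t

lemma baseChange_naturality {q : M ⥤ P} {κ : P ⥤ B} {m : M ⥤ A} (α : q ⋙ κ ⟶ m ⋙ u)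
    {t : (D.pull u).obj Z ⟶ Y} {t' : (D.pull u).obj Z' ⟶ Y'} (a : Z ⟶ Z') (b : Y ⟶ Y')
    (e : (D.pull u).map a ≫ t' = t ≫ b) :
    (D.pull q).map ((D.pull κ).map a) ≫ baseChange α t' =
      baseChange α t ≫ (D.pull m).map b := by
  have h1 := (D.pullComp q κ).inv.naturality a
  have h2 := (D.pullMap α).naturality a
  have h3 := (D.pullComp m u).hom.naturality a
  simp only [Category.assoc, ← Functor.map_comp, ← e]
  erw [reassoc_of% h1, reassoc_of% h2, reassoc_of% h3]
  rw [Functor.map_comp]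

lemma baseChange_naturality' {q : M ⥤ P} {κ : P ⥤ B} {m : M ⥤ A} (α : q ⋙ κ ⟶ m ⋙ u)
    {t : (D.pull u).obj Z ⟶ Y} {t' : (D.pull u).obj Z' ⟶ Y} (a : Z ⟶ Z')
    (e : (D.pull u).map a ≫ t' = t) :
    (D.pull q).map ((D.pull κ).map a) ≫ baseChange α t' = baseChange α t := by
  rw [baseChange_naturality α (t := t) a (𝟙 Y) (by rw [e, Category.comp_id]),
    CategoryTheory.Functor.map_id, Category.comp_id]

lemma restr_baseChange (F : N ⥤ M) {q : M ⥤ P} {κ : P ⥤ B} {m : M ⥤ A} (α : q ⋙ κ ⟶ m ⋙ u)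
    (t : (D.pull u).obj Z ⟶ Y) :
    restr F (baseChange α t) = baseChange (q := F ⋙ q) (m := F ⋙ m) (Functor.whiskerLeft F α) t ≫
      (D.pullComp F m).hom.app Y := by
  have h1 := (D.pullComp F m).hom.naturality t
  simp only [restr, baseChange, Category.assoc, Functor.map_comp]
  erw [reassoc_of% D.pullComp_assoc_inv', ← reassoc_of% D.pullMap_whiskerLeft,
    ← reassoc_of% D.pullComp_assoc]
  erw [h1]
  rfl

variable [IsDiagramCategory 𝒟]

/-- Limits may be computed by restricting along a functor which has a right adjoint. -/
lemma isRan_restr_iff {F : N ⥤ M} {G : M ⥤ N} (adj : F ⊣ G) {q : M ⥤ Dia.pt 𝒟}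
    {V : D.cat (Dia.pt 𝒟)} {Z : D.cat M} (t : (D.pull q).obj V ⟶ Z) :
    IsRan (F ⋙ q) (restr F t) ↔ IsRan q t := by
  rw [← (isRan_pullAdj adj Z).paste_iff]
  have hcell : IsIso (Functor.whiskerRight adj.counit q) :=
    @NatIso.isIso_of_isIso_app _ _ _ _ _ _ _ fun x => ⟨eqToHom (Subsingleton.elim _ _),
      Subsingleton.elim _ _, Subsingleton.elim _ _⟩
  rw [← IsRan.cell_iff (t := t) (u' := (G ⋙ F) ⋙ q) (Functor.whiskerRight adj.counit q)]
  refine iff_of_eq (congrArg (IsRan ((G ⋙ F) ⋙ q)) ?_)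
  have h1 := (D.pullComp G F).inv.naturality t
  have h2 := (D.pullMap adj.counit).naturality t
  have h3 := (D.pullId M).hom.naturality t
  have h4 := (reassoc_of% (D.pullMap_whiskerRight adj.counit q V)) ((D.pullId M).hom.app _ ≫ t)
  have h5 : (D.pullAdj adj).counit.app Z = (D.pullComp G F).inv.app Z ≫
    (D.pullMap adj.counit).app Z ≫ (D.pullId M).hom.app Z := rfl
  rw [h5]
  simp only [paste, restr, Functor.map_comp, Category.assoc]
  erw [reassoc_of% h1, reassoc_of% h2, h3]
  erw [← reassoc_of% D.pullComp_assoc, Iso.hom_inv_id_app_assoc]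
  erw [← h4, D.pullComp_id_left, Iso.inv_hom_id_app_assoc]

/-- The functor to a comma category determined by a square. -/
@[simps]
def toUnder {k : B} {m : M ⥤ A} (α : M.toPt ⋙ Dia.point k ⟶ m ⋙ u) : M ⥤ StructuredArrow k u where
  obj x := StructuredArrow.mk (Y := m.obj x) (α.app x)
  map {x y} f := StructuredArrow.homMk (m.map f)
    ((α.naturality f).symm.trans (Category.id_comp (α.app y)))

/-- Right Kan extensions in a derivator are computed pointwise, where the comma category may be
replaced by any category mapping to it by a left adjoint. -/
lemma IsRan.baseChange [D.IsDerivator] {t : (D.pull u).obj Z ⟶ Y} (h : IsRan u t) {k : B}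
    {m : M ⥤ A} (α : M.toPt ⋙ Dia.point k ⟶ m ⋙ u) (hα : (toUnder α).IsLeftAdjoint) :
    IsRan M.toPt (Prederivator.baseChange α t) := by
  obtain ⟨a, ha⟩ := h.exists_lift (D.ranCounit u Y)
  have := (D.isRan_ranCounit u Y).isIso' h a ha
  have h1 : IsRan (Dia.under u k).toPt
      (Prederivator.baseChange (M := Dia.under u k) (underCell u k) (D.ranCounit u Y)) := by
    rw [isRan_iff_isIso_homEquiv (D.ranAdj (Dia.under u k).toPt)]
    exact IsDerivator.isIso_ranMate u k Y
  have h2 : IsRan (Dia.under u k).toPt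
      (Prederivator.baseChange (M := Dia.under u k) (underCell u k) t) := by
    rwa [← IsRan.iso_comp_iff ((D.pull (Dia.point k)).map a),
      baseChange_naturality' (M := Dia.under u k) _ a ha]
  obtain ⟨G, ⟨adj⟩⟩ := hα
  rw [← isRan_restr_iff (M := Dia.under u k) adj, restr_baseChange (M := Dia.under u k),
    IsRan.comp_iso_iff] at h2
  exact h2

lemma pull_point_isIso {k k' : B} (e : k ≅ k') {X Y : D.cat B} (f : X ⟶ Y)
    (h : IsIso ((D.pull (Dia.point k)).map f)) : IsIso ((D.pull (Dia.point k')).map f) := by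
  let α : Dia.point k ⟶ Dia.point k' := { app := fun _ => e.hom }
  have : IsIso α := @NatIso.isIso_of_isIso_app _ _ _ _ _ _ _ fun x => inferInstanceAs (IsIso e.hom)
  have h1 := isIso_pullMap_app (D := D) α X
  have h2 := isIso_pullMap_app (D := D) α Y
  have h3 := (D.pullMap α).naturality f
  have : IsIso ((D.pullMap α).app X ≫ (D.pull (Dia.point k')).map f) := by
    rw [← h3]; infer_instance
  exact IsIso.of_isIso_comp_left ((D.pullMap α).app X) _

/-- The pointwise criterion for right Kan extensions. -/
lemma isRan_of_pointwise [D.IsDerivator] {t : (D.pull u).obj Z ⟶ Y}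
    (h : ∀ k : B, ∃ (k' : B) (_ : k' ≅ k) (M : Dia 𝒟) (m : M ⥤ A)
      (α : M.toPt ⋙ Dia.point k' ⟶ m ⋙ u), (toUnder α).IsLeftAdjoint ∧
        IsRan M.toPt (Prederivator.baseChange α t)) : IsRan u t := by
  have hc := D.isRan_ranCounit u Y
  obtain ⟨a, ha⟩ := hc.exists_lift t
  suffices IsIso a by rw [← ha]; exact (IsRan.iso_comp_iff a).2 hc
  refine IsDerivator.isIso_of_pointwise a fun k => ?_
  obtain ⟨k', e, M, m, α, hα, ht⟩ := h k
  refine pull_point_isIso e a ?_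
  exact ht.isIso' (hc.baseChange α hα) _ (baseChange_naturality' α a ha)

end Cone

/-! ### Morphisms of prederivators and right Kan extensions -/

section Morphism
variable {D E : Prederivator.{w, v, u} 𝒟} (L : D ⟶ E) {A B C M N P : Dia 𝒟}

/-- The functor `L_A : D(A) ⥤ E(A)`. -/
abbrev fn (A : Dia 𝒟) : D.cat A ⥤ E.cat A := (L.app (op A)).toFunctor

/-- The coherence isomorphism `L_A u^* ≅ u^* L_B`. -/
abbrev natIso (u : A ⥤ B) : D.pull u ⋙ fn L A ≅ fn L B ⋙ E.pull u :=
  Cat.Hom.toNatIso (L.naturality (Dia.hom u).op)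

lemma natIso_pullMap {u u' : A ⥤ B} (α : u ⟶ u') (Z : D.cat B) :
    (fn L A).map ((D.pullMap α).app Z) ≫ (natIso L u').hom.app Z =
      (natIso L u).hom.app Z ≫ (E.pullMap α).app ((fn L B).obj Z) :=
  congr($(L.naturality_naturality (Bicategory.Opposite.op2 (Dia.hom₂ α))).toNatTrans.app Z)

lemma natIso_pullComp (u : A ⥤ B) (v : B ⥤ C) (Z : D.cat C) :
    (natIso L (u ⋙ v)).hom.app Z ≫ (E.pullComp u v).hom.app ((fn L C).obj Z) =
      (fn L A).map ((D.pullComp u v).hom.app Z) ≫ (natIso L u).hom.app ((D.pull v).obj Z) ≫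
        (E.pull u).map ((natIso L v).hom.app Z) := by
  have h : (natIso L (u ⋙ v)).hom.app Z ≫ (E.pullComp u v).hom.app ((fn L C).obj Z) =
      (fn L A).map ((D.pullComp u v).hom.app Z) ≫ 𝟙 _ ≫
        (natIso L u).hom.app ((D.pull v).obj Z) ≫ 𝟙 _ ≫
        (E.pull u).map ((natIso L v).hom.app Z) ≫ 𝟙 _ :=
    congr($(L.naturality_comp (Dia.hom v).op (Dia.hom u).op).toNatTrans.app Z)
  rw [h]
  simp only [Category.id_comp]
  erw [Category.comp_id]

lemma natIso_pullComp_inv (u : A ⥤ B) (v : B ⥤ C) (Z : D.cat C) :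
    (natIso L u).hom.app ((D.pull v).obj Z) ≫ (E.pull u).map ((natIso L v).hom.app Z) ≫
      (E.pullComp u v).inv.app ((fn L C).obj Z) =
      (fn L A).map ((D.pullComp u v).inv.app Z) ≫ (natIso L (u ⋙ v)).hom.app Z := by
  rw [← cancel_mono ((E.pullComp u v).hom.app ((fn L C).obj Z)), Category.assoc, Category.assoc,
    Category.assoc, Iso.inv_hom_id_app, natIso_pullComp, ← Functor.map_comp_assoc,
    Iso.inv_hom_id_app, CategoryTheory.Functor.map_id, Category.id_comp]
  erw [Category.comp_id]

variable {u : A ⥤ B} {Z Z' : D.cat B} {Y Y' : D.cat A}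

/-- The image of `t : u^* Z ⟶ Y` under a morphism of prederivators. -/
def mapCone (t : (D.pull u).obj Z ⟶ Y) : (E.pull u).obj ((fn L B).obj Z) ⟶ (fn L A).obj Y :=
  (natIso L u).inv.app Z ≫ (fn L A).map t

lemma mapCone_naturality {t : (D.pull u).obj Z ⟶ Y} {t' : (D.pull u).obj Z' ⟶ Y'} (a : Z ⟶ Z')
    (b : Y ⟶ Y') (e : (D.pull u).map a ≫ t' = t ≫ b) :
    (E.pull u).map ((fn L B).map a) ≫ mapCone L t' = mapCone L t ≫ (fn L A).map b := by
  have h := (natIso L u).inv.naturality a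
  rw [mapCone, mapCone, Category.assoc, ← Functor.map_comp, ← e, Functor.map_comp]
  erw [reassoc_of% h]

lemma natIso_hom_mapCone (t : (D.pull u).obj Z ⟶ Y) :
    (natIso L u).hom.app Z ≫ mapCone L t = (fn L A).map t :=
  Iso.hom_inv_id_app_assoc _ _ _

lemma pull_natIso_hom_mapCone (m : M ⥤ A) (t : (D.pull u).obj Z ⟶ Y) :
    (E.pull m).map ((natIso L u).hom.app Z) ≫ (E.pull m).map (mapCone L t) =
      (E.pull m).map ((fn L A).map t) := by
  rw [← natIso_hom_mapCone, Functor.map_comp]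

lemma mapCone_baseChange {q : M ⥤ P} {κ : P ⥤ B} {m : M ⥤ A} (α : q ⋙ κ ⟶ m ⋙ u)
    (t : (D.pull u).obj Z ⟶ Y) :
    (E.pull q).map ((natIso L κ).hom.app Z) ≫ baseChange α (mapCone L t) =
      mapCone L (baseChange α t) ≫ (natIso L m).hom.app Y := by
  have h1 := (natIso L m).hom.naturality t
  rw [← cancel_epi ((natIso L q).hom.app ((D.pull κ).obj Z)), reassoc_of% natIso_hom_mapCone]
  erw [reassoc_of% natIso_pullComp_inv, ← reassoc_of% natIso_pullMap, reassoc_of% natIso_pullComp,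
    pull_natIso_hom_mapCone, ← h1]
  simp only [baseChange, Functor.map_comp, Category.assoc]
  rfl

lemma mapCone_paste {v : B ⥤ C} {V : D.cat C} (t : (D.pull u).obj Z ⟶ Y)
    (s : (D.pull v).obj V ⟶ Z) :
    mapCone L (paste t s) = paste (mapCone L t) (mapCone L s) := by
  have h1 := (natIso L u).hom.naturality s
  rw [← cancel_epi ((natIso L (u ⋙ v)).hom.app V), natIso_hom_mapCone]
  erw [reassoc_of% natIso_pullComp, reassoc_of% pull_natIso_hom_mapCone, ← reassoc_of% h1,
    natIso_hom_mapCone, Functor.map_comp, Functor.map_comp]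

section
variable [D.HasKanExtensions] [E.HasKanExtensions]

lemma isRan_mapCone_iff {t : (D.pull u).obj Z ⟶ Y} (ht : IsRan u t) :
    IsRan u (mapCone L t) ↔ IsIso (ranComparison L u Y) := by
  obtain ⟨a, ha⟩ := ht.exists_lift (D.ranCounit u Y)
  have := (D.isRan_ranCounit u Y).isIso' ht a ha
  rw [← IsRan.iso_comp_iff ((fn L B).map a),
    mapCone_naturality L (t := D.ranCounit u Y) a (𝟙 Y) (by rw [ha, Category.comp_id]),
    IsRan.comp_iso_iff, isRan_iff_isIso_homEquiv (E.ranAdj u)]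
  rfl

lemma commutesWithRan_iff : CommutesWithRan L u ↔
    ∀ ⦃Z : D.cat B⦄ ⦃Y : D.cat A⦄ (t : (D.pull u).obj Z ⟶ Y), IsRan u t → IsRan u (mapCone L t) :=
  ⟨fun h _ _ _ ht => (isRan_mapCone_iff L ht).2 (h _),
    fun h Y => (isRan_mapCone_iff L (D.isRan_ranCounit u Y)).1 (h _ (D.isRan_ranCounit u Y))⟩

end

section
variable [IsDiagramCategory 𝒟] [D.IsDerivator] [E.IsDerivator]

/-- A morphism which preserves the limits computing the values of a right Kan extension preserves
this Kan extension. -/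
lemma commutesWithRan_of_pointwise
    (h : ∀ k : B, ∃ (k' : B) (_ : k' ≅ k) (M : Dia 𝒟) (m : M ⥤ A)
      (α : M.toPt ⋙ Dia.point k' ⟶ m ⋙ u), (toUnder α).IsLeftAdjoint ∧
        CommutesWithRan L M.toPt) : CommutesWithRan L u := by
  rw [commutesWithRan_iff]
  intro Z Y t ht
  refine isRan_of_pointwise fun k => ?_
  obtain ⟨k', e, M, m, α, hα, hM⟩ := h k
  refine ⟨k', e, M, m, α, hα, ?_⟩
  rw [← IsRan.iff_of_isIso _ _ (mapCone_baseChange L α t)]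
  exact (commutesWithRan_iff L).1 hM _ (ht.baseChange α hα)

end

end Morphism

section Adjunction
universe v₁ u₁
variable {D E : Prederivator.{w, v, u} 𝒟} {L : D ⟶ E} {R : E ⟶ D}
  (adj : Bicategory.Adjunction L R) {A B : Dia 𝒟}

/-- An adjunction of prederivators gives an adjunction of functors at each diagram. -/
def adjAt (A : Dia 𝒟) : fn L A ⊣ fn R A where
  unit := (adj.unit.as.app (op A)).toNatTrans
  counit := (adj.counit.as.app (op A)).toNatTrans
  left_triangle_components X := by
    have h := congr(($(adj.left_triangle).as.app (op A)).toNatTrans.app X)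
    simp only [leftZigzag, bicategoricalComp] at h
    simp at h
    exact h.trans (Category.id_comp _)
  right_triangle_components X := by
    have h := congr(($(adj.right_triangle).as.app (op A)).toNatTrans.app X)
    simp only [rightZigzag, bicategoricalComp] at h
    simp at h
    exact h.trans (Category.id_comp _)

/-- The unit of an adjunction of prederivators at an object. -/
def unitAt (Z : D.cat A) : Z ⟶ (fn R A).obj ((fn L A).obj Z) := (adjAt adj A).unit.app Z

lemma unitAt_naturality {Z Z' : D.cat A} (f : Z ⟶ Z') :
    f ≫ unitAt adj Z' = unitAt adj Z ≫ (fn R A).map ((fn L A).map f) :=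
  (adjAt adj A).unit.naturality f

/-- The unit is compatible with restriction. -/
lemma unitAt_pull (u : A ⥤ B) (Z : D.cat B) :
    unitAt adj ((D.pull u).obj Z) ≫ (fn R A).map ((natIso L u).hom.app Z) ≫
      (natIso R u).hom.app ((fn L B).obj Z) = (D.pull u).map (unitAt adj Z) := by
  have h := congr($(adj.unit.as.naturality (Dia.hom u).op).toNatTrans.app Z)
  simp only [Pseudofunctor.StrongTrans.categoryStruct_comp_naturality_hom,
    Pseudofunctor.StrongTrans.categoryStruct_id_naturality_hom] at h
  have h' : unitAt adj ((D.pull u).obj Z) ≫ 𝟙 _ ≫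
      (fn R A).map ((natIso L u).hom.app Z) ≫ 𝟙 _ ≫ (natIso R u).hom.app ((fn L B).obj Z) ≫
      𝟙 _ = (𝟙 _ ≫ 𝟙 _) ≫ (D.pull u).map (unitAt adj Z) := h
  simp only [Category.id_comp] at h'
  erw [Category.comp_id] at h'
  exact h'

variable {u : A ⥤ B} {Z Z' : D.cat B} {Y Y' : D.cat A}

lemma unit_mapCone (t : (D.pull u).obj Z ⟶ Y) :
    (D.pull u).map (unitAt adj Z) ≫ mapCone R (mapCone L t) =
      t ≫ unitAt adj Y := by
  rw [unitAt_naturality, ← unitAt_pull, Category.assoc, Category.assoc, natIso_hom_mapCone,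
    ← Functor.map_comp, natIso_hom_mapCone]

/-- An object of `D(A)` is local if the unit of the reflection is invertible on it. -/
def IsLocal (Z : D.cat A) : Prop := IsIso (unitAt adj Z)

variable {adj} in
lemma IsLocal.bijective {Z V V' : D.cat A} (h : IsLocal adj Z) (f : V ⟶ V')
    (hf : IsIso ((fn L A).map f)) : Function.Bijective fun g : V' ⟶ Z => f ≫ g := by
  unfold IsLocal at h
  constructor
  · intro g g' e
    rw [← cancel_mono (unitAt adj Z)]
    have h1 : (fn L A).map g = (fn L A).map g' := by
      rw [← cancel_epi ((fn L A).map f), ← Functor.map_comp, ← Functor.map_comp]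
      exact congrArg _ e
    rw [unitAt_naturality, unitAt_naturality, h1]
  · intro h
    refine ⟨unitAt adj V' ≫ (fn R A).map (inv ((fn L A).map f) ≫ (fn L A).map h) ≫
      inv (unitAt adj Z), ?_⟩
    dsimp only
    rw [reassoc_of% unitAt_naturality, ← Functor.map_comp_assoc, IsIso.hom_inv_id_assoc,
      ← reassoc_of% unitAt_naturality, IsIso.hom_inv_id, Category.comp_id]

lemma isIso_adjAt_counit (hadj : IsReflection adj) (A : Dia 𝒟) :
    IsIso (adjAt adj A).counit := by
  have : IsIso adj.counit := hadj
  refine ⟨((inv adj.counit).as.app (op A)).toNatTrans, ?_, ?_⟩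
  · exact congr(($(IsIso.hom_inv_id adj.counit).as.app (op A)).toNatTrans)
  · exact congr(($(IsIso.inv_hom_id adj.counit).as.app (op A)).toNatTrans)

/-- The right adjoint of a reflection is fully faithful. -/
noncomputable def reflFullyFaithful (hadj : IsReflection adj) (A : Dia 𝒟) :
    (fn R A).FullyFaithful :=
  have := isIso_adjAt_counit adj hadj A
  (adjAt adj A).fullyFaithfulROfIsIsoCounit

lemma isIso_map_unit (hadj : IsReflection adj) (Z : D.cat A) :
    IsIso ((fn L A).map (unitAt adj Z)) := by
  have := isIso_adjAt_counit adj hadj A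
  have h : IsIso ((fn L A).map (unitAt adj Z) ≫
      (adjAt adj A).counit.app ((fn L A).obj Z)) := by
    have h1 : (fn L A).map (unitAt adj Z) ≫ (adjAt adj A).counit.app ((fn L A).obj Z) = 𝟙 _ :=
      (adjAt adj A).left_triangle_components Z
    rw [h1]; infer_instance
  exact IsIso.of_isIso_comp_right _ ((adjAt adj A).counit.app ((fn L A).obj Z))

lemma isLocal_iff_mem_essImage (hadj : IsReflection adj) (Z : D.cat A) :
    IsLocal adj Z ↔ (fn R A).essImage Z := by
  have := (reflFullyFaithful adj hadj A).full
  have := (reflFullyFaithful adj hadj A).faithful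
  exact (adjAt adj A).isIso_unit_app_iff_mem_essImage

lemma isLocal_obj (hadj : IsReflection adj) (X : E.cat A) : IsLocal adj ((fn R A).obj X) :=
  (isLocal_iff_mem_essImage adj hadj _).2 ((fn R A).obj_mem_essImage X)

lemma isLocal_of_iso (hadj : IsReflection adj) {Z Z' : D.cat A} (e : Z ≅ Z')
    (h : IsLocal adj Z) : IsLocal adj Z' := by
  rw [isLocal_iff_mem_essImage adj hadj] at h ⊢
  exact h.ofIso e

/-- Local objects are those orthogonal to the morphisms inverted by the reflection. -/
lemma isLocal_of_surjective (hadj : IsReflection adj) {Z : D.cat A}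
    (h : ∀ {V V' : D.cat A} (f : V ⟶ V'), IsIso ((fn L A).map f) →
      Function.Surjective fun g : V' ⟶ Z => f ≫ g) : IsLocal adj Z := by
  have hu := isIso_map_unit adj hadj Z
  obtain ⟨r, hr⟩ := h (unitAt adj Z) hu (𝟙 Z)
  have hr : unitAt adj Z ≫ r = 𝟙 Z := hr
  refine ⟨r, hr, ((isLocal_obj adj hadj _).bijective _ hu).1 ?_⟩
  dsimp only
  rw [reassoc_of% hr, Category.comp_id]

lemma isIso_map_of_bijective (hadj : IsReflection adj) {V V' : D.cat A} (f : V ⟶ V')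
    (h : ∀ Z : D.cat A, IsLocal adj Z → Function.Bijective fun g : V' ⟶ Z => f ≫ g) :
    IsIso ((fn L A).map f) := by
  rw [isIso_iff_coyoneda_map_bijective]
  intro X
  have h1 := h _ (isLocal_obj adj hadj X)
  rw [← ((adjAt adj A).homEquiv V X).comp_bijective]
  rw [← ((adjAt adj A).homEquiv V' X).bijective_comp] at h1
  refine (iff_of_eq (congrArg _ (funext fun g => ?_))).2 h1
  exact (adjAt adj A).homEquiv_naturality_left f g

lemma isIso_map_pull (u : A ⥤ B) {Z Z' : D.cat B} (f : Z ⟶ Z') (hf : IsIso ((fn L B).map f)) :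
    IsIso ((fn L A).map ((D.pull u).map f)) := by
  have h := (natIso L u).hom.naturality f
  have : IsIso ((fn L A).map ((D.pull u).map f) ≫ (natIso L u).hom.app Z') := by
    erw [h]
    exact inferInstanceAs (IsIso ((natIso L u).hom.app Z ≫ (E.pull u).map ((fn L B).map f)))
  exact IsIso.of_isIso_comp_right _ ((natIso L u).hom.app Z')

lemma IsRan.isLocal (hadj : IsReflection adj) {t : (D.pull u).obj Z ⟶ Y} (ht : IsRan u t)
    (hY : IsLocal adj Y) : IsLocal adj Z := by
  refine isLocal_of_surjective adj hadj fun {V V'} f hf g => ?_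
  obtain ⟨k, hk⟩ := (hY.bijective ((D.pull u).map f) (isIso_map_pull u f hf)).2
    ((D.pull u).map g ≫ t)
  obtain ⟨a, ha⟩ := ht.exists_lift k
  refine ⟨a, ht.hom_ext ?_⟩
  dsimp only at hk ⊢
  rw [Functor.map_comp, Category.assoc, ha, hk]

/-- The right adjoint of a reflection is fully faithful, so it reflects right Kan extensions. -/
lemma IsRan.of_mapCone (hadj : IsReflection adj) {Z : E.cat B} {Y : E.cat A}
    {t : (E.pull u).obj Z ⟶ Y} (ht : IsRan u (mapCone R t)) : IsRan u t := by
  intro W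
  have h1 := ht ((fn R B).obj W)
  rw [← (reflFullyFaithful adj hadj B).homEquiv.bijective_comp] at h1
  rw [← ((reflFullyFaithful adj hadj A).homEquiv.trans
    (((natIso R u).app W).homFromEquiv)).comp_bijective]
  refine (iff_of_eq (congrArg _ (funext fun g => ?_))).2 h1
  have h2 := (natIso R u).inv.naturality g
  simp only [Function.comp_apply, Functor.FullyFaithful.homEquiv_apply, Equiv.trans_apply,
    Iso.homFromEquiv_apply, Functor.map_comp, mapCone]
  erw [reassoc_of% h2]
  rfl

/-- The reflection preserves a right Kan extension `t` of a local object: the unit identifies `t`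
with the image of its reflection under the right adjoint, which reflects right Kan extensions. -/
lemma IsRan.mapCone_of_isLocal (hadj : IsReflection adj) {t : (D.pull u).obj Z ⟶ Y}
    (ht : IsRan u t) (hY : IsLocal adj Y) :
    IsRan u (mapCone L t) := by
  have h1 := ht.isLocal adj hadj hY
  unfold IsLocal at h1 hY
  rw [IsRan.iff_of_isIso _ _ (unit_mapCone adj t)] at ht
  exact ht.of_mapCone adj hadj

/-- A right Kan extension is preserved by the reflection if it can be compared, up to morphisms
inverted by the reflection, with a right Kan extension of a local object. -/
lemma IsRan.mapCone_of_compare (hadj : IsReflection adj) {t : (D.pull u).obj Z ⟶ Y}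
    {t' : (D.pull u).obj Z' ⟶ Y'}
    (ht' : IsRan u t') (hY' : IsLocal adj Y') (a : Z ⟶ Z') (b : Y ⟶ Y')
    (e : (D.pull u).map a ≫ t' = t ≫ b) (ha : IsIso ((fn L B).map a))
    (hb : IsIso ((fn L A).map b)) : IsRan u (mapCone L t) :=
  (IsRan.iff_of_isIso _ _ (mapCone_naturality L a b e)).2 (ht'.mapCone_of_isLocal adj hadj hY')

lemma isLocal_of_pointwise [IsDiagramCategory 𝒟] [D.IsDerivator] {Z : D.cat A}
    (h : ∀ k : A, IsLocal adj ((D.pull (Dia.point k)).obj Z)) : IsLocal adj Z := by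
  refine IsDerivator.isIso_of_pointwise _ fun k => ?_
  have := h k
  unfold IsLocal at this
  rw [← unitAt_pull]
  infer_instance

end Adjunction

/-! ### Values of a coherent diagram and the arrows between them -/

section Values
variable [IsDiagramCategory 𝒟] {D E : Prederivator.{w, v, u} 𝒟} {A B : Dia 𝒟}

/-- The transformation of functors `e ⥤ B` determined by an arrow of `B`. -/
def pointHom {k k' : B} (f : k ⟶ k') : Dia.point k ⟶ Dia.point k' where
  app _ := f
  naturality _ _ _ := (Category.id_comp f).trans (Category.comp_id f).symm

/-- The arrow `k^* Z ⟶ k'^* Z` determined by an arrow `k ⟶ k'`. -/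
def arr (Z : D.cat B) {k k' : B} (f : k ⟶ k') :
    (D.pull (Dia.point k)).obj Z ⟶ (D.pull (Dia.point k')).obj Z :=
  (D.pullMap (pointHom f)).app Z

lemma arr_id (Z : D.cat B) (k : B) : arr Z (𝟙 k) = 𝟙 _ := by
  have h : pointHom (𝟙 k) = 𝟙 (Dia.point k) := rfl
  rw [arr, h, pullMap_id]; rfl

lemma arr_comp (Z : D.cat B) {k k' k'' : B} (f : k ⟶ k') (g : k' ⟶ k'') :
    arr Z (f ≫ g) = arr Z f ≫ arr Z g :=
  D.pullMap_app_comp (pointHom f) (pointHom g) Z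

/-- The cell identifying the composite of a point with a functor. -/
def pointCell (u : A ⥤ B) (a : A) : Dia.point a ⋙ u ≅ Dia.point (u.obj a) :=
  NatIso.ofComponents (fun _ => Iso.refl _) fun _ =>
    (Category.comp_id _).trans ((u.map_id a).trans (Category.id_comp _).symm)

/-- The value of `u^* Z` at `a` is the value of `Z` at `u a`. -/
noncomputable def valIso (u : A ⥤ B) (a : A) (Z : D.cat B) :
    (D.pull (Dia.point a)).obj ((D.pull u).obj Z) ≅ (D.pull (Dia.point (u.obj a))).obj Z :=
  have := isIso_pullMap_app (D := D) (pointCell u a).hom Z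
  ((D.pullComp (Dia.point a) u).symm.app Z) ≪≫ asIso ((D.pullMap (pointCell u a).hom).app Z)

lemma valIso_hom (u : A ⥤ B) (a : A) (Z : D.cat B) : (valIso u a Z).hom =
    (D.pullComp (Dia.point a) u).inv.app Z ≫ (D.pullMap (pointCell u a).hom).app Z := rfl

lemma arr_valIso (u : A ⥤ B) (Z : D.cat B) {a a' : A} (f : a ⟶ a') :
    arr ((D.pull u).obj Z) f ≫ (valIso u a' Z).hom =
      (valIso u a Z).hom ≫ arr Z (u.map f) := by
  have h : Functor.whiskerRight (pointHom f) u ≫ (pointCell u a').hom =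
      (pointCell u a).hom ≫ pointHom (u.map f) :=
    NatTrans.ext (funext fun _ => (Category.comp_id _).trans (Category.id_comp _).symm)
  rw [arr, arr, valIso_hom, valIso_hom, Category.assoc, ← pullMap_app_comp, ← h,
    pullMap_app_comp, reassoc_of% pullComp_inv_whiskerRight]

lemma pullMap_valIso {u u' : A ⥤ B} (β : u ⟶ u') (Z : D.cat B) (a : A) :
    (D.pull (Dia.point a)).map ((D.pullMap β).app Z) ≫ (valIso u' a Z).hom =
      (valIso u a Z).hom ≫ arr Z (β.app a) := by
  have h : Functor.whiskerLeft (Dia.point a) β ≫ (pointCell u' a).hom =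
      (pointCell u a).hom ≫ pointHom (β.app a) :=
    NatTrans.ext (funext fun _ => (Category.comp_id _).trans (Category.id_comp _).symm)
  rw [arr, valIso_hom, valIso_hom, Category.assoc, ← pullMap_app_comp, ← h,
    pullMap_app_comp, reassoc_of% pullComp_inv_whiskerLeft]

lemma isIso_iff_of_comm {C : Type*} [Category* C] {X Y X' Y' : C} {f : X ⟶ Y} {g : X' ⟶ Y'}
    (a : X ⟶ X') (b : Y ⟶ Y') [IsIso a] [IsIso b] (h : f ≫ b = a ≫ g) : IsIso f ↔ IsIso g :=
  ⟨fun _ => by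
    have : IsIso (a ≫ g) := h ▸ inferInstance
    exact IsIso.of_isIso_comp_left a g, fun _ => by
    have : IsIso (f ≫ b) := h ▸ inferInstance
    exact IsIso.of_isIso_comp_right f b⟩

lemma isIso_pullMap_app_iff [D.IsDerivator] {u u' : A ⥤ B} (β : u ⟶ u') (Z : D.cat B) :
    IsIso ((D.pullMap β).app Z) ↔ ∀ a, IsIso (arr Z (β.app a)) := by
  constructor
  · intro _ a
    exact (isIso_iff_of_comm _ _ (pullMap_valIso β Z a)).1 inferInstance
  · intro h
    exact IsDerivator.isIso_of_pointwise _ fun a =>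
      (isIso_iff_of_comm _ _ (pullMap_valIso β Z a)).2 (h a)

variable (L : D ⟶ E)

/-- The morphism of prederivators `L` inverts the arrow of `Z` at `f`. -/
def Inverts (Z : D.cat B) {k k' : B} (f : k ⟶ k') : Prop :=
  IsIso ((fn L (Dia.pt 𝒟)).map (arr Z f))

lemma inverts_iff (Z : D.cat B) {k k' : B} (f : k ⟶ k') :
    Inverts L Z f ↔ IsIso (arr ((fn L B).obj Z) f) :=
  isIso_iff_of_comm _ _ (natIso_pullMap L (pointHom f) Z)

variable {L}

lemma Inverts.id (Z : D.cat B) (k : B) : Inverts L Z (𝟙 k) := by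
  rw [Inverts, arr_id]; infer_instance

lemma Inverts.comp {Z : D.cat B} {k k' k'' : B} {f : k ⟶ k'} {g : k' ⟶ k''}
    (hf : Inverts L Z f) (hg : Inverts L Z g) : Inverts L Z (f ≫ g) := by
  unfold Inverts at *
  rw [arr_comp, Functor.map_comp]; infer_instance

lemma Inverts.of_comp_right {Z : D.cat B} {k k' k'' : B} {f : k ⟶ k'} {g : k' ⟶ k''}
    (hfg : Inverts L Z (f ≫ g)) (hg : Inverts L Z g) : Inverts L Z f := by
  unfold Inverts at *
  rw [arr_comp, Functor.map_comp] at hfg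
  exact IsIso.of_isIso_comp_right _ ((fn L (Dia.pt 𝒟)).map (arr Z g))

lemma inverts_pull_iff (u : A ⥤ B) (Z : D.cat B) {a a' : A} (f : a ⟶ a') :
    Inverts L ((D.pull u).obj Z) f ↔ Inverts L Z (u.map f) :=
  isIso_iff_of_comm ((fn L _).map (valIso u a Z).hom) ((fn L _).map (valIso u a' Z).hom) (by
    rw [← Functor.map_comp, ← Functor.map_comp, arr_valIso])

lemma Inverts.of_iso {Z Z' : D.cat B} (e : Z ≅ Z') {k k' : B} {f : k ⟶ k'}
    (h : Inverts L Z f) : Inverts L Z' f := by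
  refine (isIso_iff_of_comm ((fn L _).map ((D.pull _).map e.hom))
    ((fn L _).map ((D.pull _).map e.hom)) ?_).1 h
  rw [← Functor.map_comp, ← Functor.map_comp]
  exact congrArg _ ((D.pullMap (pointHom f)).naturality e.hom).symm

variable {J : Dia 𝒟}

/-- The arrow `(j, 0) ⟶ (j, 1)` of `J × [1]`. -/
abbrev intervalArrow (j : J) : (⟨j, ⟨0⟩⟩ : J × Interval.{w}) ⟶ ⟨j, ⟨1⟩⟩ := (intervalCell J).app j

lemma isIso_dia_iff [D.IsDerivator] (X : D.cat (J.prod (Dia.interval 𝒟))) :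
    IsIso (D.dia X) ↔ ∀ j : J, IsIso (arr (B := J.prod (Dia.interval 𝒟)) X (intervalArrow j)) :=
  isIso_pullMap_app_iff (B := J.prod (Dia.interval 𝒟)) (intervalCell J) X

lemma locals_iff [E.IsDerivator] (X : D.cat (J.prod (Dia.interval 𝒟))) :
    (locals L).prop (op J) X ↔
      ∀ j : J, Inverts (B := J.prod (Dia.interval 𝒟)) L X (intervalArrow j) := by
  simp only [inverts_iff]
  exact isIso_dia_iff _

lemma locals_edge_iff [E.IsDerivator] (c : Interval.{w}) (X : D.cat (Dia.square 𝒟)) :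
    (locals L).prop (op (Dia.pt 𝒟)) (D.edge c X) ↔
      Inverts (B := Dia.square 𝒟) L X (k := (⟨0⟩, c)) (k' := (⟨1⟩, c))
        (homOfLE (by simp), 𝟙 c) := by
  refine (locals_iff (J := Dia.pt 𝒟) _).trans ?_
  refine (forall_congr' fun j => inverts_pull_iff (A := (Dia.pt 𝒟).prod (Dia.interval 𝒟))
    (B := Dia.square 𝒟) _ _ _).trans ?_
  exact ⟨fun h => h ⟨PUnit.unit⟩, fun h _ => h⟩

end Values

end Prederivator
end Derivators

namespace Derivators

variable {𝒟 : ObjectProperty Cat.{w, w}}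

/-! ### Thin categories -/

section Thin

instance (A B : Type*) [Category* A] [Category* B] [Quiver.IsThin A] [Quiver.IsThin B] :
    Quiver.IsThin (A × B) := fun _ _ =>
  ⟨fun _ _ => Prod.ext (Subsingleton.elim _ _) (Subsingleton.elim _ _)⟩

instance (A : Type*) [Category* A] [Quiver.IsThin A] (P : ObjectProperty A) :
    Quiver.IsThin P.FullSubcategory := fun _ _ =>
  ⟨fun _ _ => ObjectProperty.hom_ext _ (Subsingleton.elim _ _)⟩

lemma nonempty_hom_prod {A B : Type*} [Category* A] [Category* B] {x y : A × B} :
    Nonempty (x ⟶ y) ↔ Nonempty (x.1 ⟶ y.1) ∧ Nonempty (x.2 ⟶ y.2) :=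
  ⟨fun ⟨f⟩ => ⟨⟨f.1⟩, ⟨f.2⟩⟩, fun ⟨⟨f⟩, ⟨g⟩⟩ => ⟨(f, g)⟩⟩

lemma nonempty_hom_fullSubcategory {A : Type*} [Category* A] {P : ObjectProperty A}
    {x y : P.FullSubcategory} : Nonempty (x ⟶ y) ↔ Nonempty (x.obj ⟶ y.obj) :=
  ⟨fun ⟨f⟩ => ⟨f.hom⟩, fun ⟨f⟩ => ⟨⟨f⟩⟩⟩

lemma nonempty_hom_chain {n : ℕ} {x y : ULift.{w} (Fin n)} :
    Nonempty (x ⟶ y) ↔ x.down ≤ y.down :=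
  ⟨fun ⟨f⟩ => f.le, fun h => ⟨homOfLE h⟩⟩

/-- The functor to a thin category with given values on objects. -/
noncomputable def thinFunctor {A B : Type*} [Category* A] [Category* B] [Quiver.IsThin B]
    (obj : A → B) (h : ∀ ⦃x y : A⦄, (x ⟶ y) → Nonempty (obj x ⟶ obj y)) : A ⥤ B where
  obj := obj
  map f := (h f).some
  map_id _ := Subsingleton.elim _ _
  map_comp _ _ := Subsingleton.elim _ _

@[simp] lemma thinFunctor_obj {A B : Type*} [Category* A] [Category* B] [Quiver.IsThin B]
    (obj : A → B) (h : ∀ ⦃x y : A⦄, (x ⟶ y) → Nonempty (obj x ⟶ obj y)) (x : A) :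
    (thinFunctor obj h).obj x = obj x := rfl

/-- A Galois connection between thin categories is an adjunction. -/
noncomputable def thinAdjunction {A B : Type*} [Category* A] [Category* B] [Quiver.IsThin A]
    [Quiver.IsThin B] (F : A ⥤ B) (G : B ⥤ A)
    (h : ∀ x y, Nonempty (F.obj x ⟶ y) ↔ Nonempty (x ⟶ G.obj y)) : F ⊣ G :=
  Adjunction.mkOfHomEquiv
    { homEquiv x y := ⟨fun f => ((h x y).1 ⟨f⟩).some, fun f => ((h x y).2 ⟨f⟩).some,
        fun _ => Subsingleton.elim _ _, fun _ => Subsingleton.elim _ _⟩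
      homEquiv_naturality_left_symm _ _ := Subsingleton.elim _ _
      homEquiv_naturality_right _ _ := Subsingleton.elim _ _ }

end Thin

/-! ### Finite categories -/

section Finite

lemma isFiniteCategory_of_thin (A : Type w) [SmallCategory A] [Finite A] [Quiver.IsThin A] :
    IsFiniteCategory A :=
  ⟨inferInstance, fun _ _ => inferInstance, fun _ _ => Subsingleton.elim _ _⟩

lemma IsFiniteCategory.prod {A B : Type w} [SmallCategory A] [SmallCategory B]
    (hA : IsFiniteCategory A) (hB : IsFiniteCategory B) : IsFiniteCategory (A × B) where
  finite_obj := have := hA.finite_obj; have := hB.finite_obj; inferInstance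
  finite_hom x y := have := hA.finite_hom x.1 y.1; have := hB.finite_hom x.2 y.2
    inferInstanceAs (Finite ((x.1 ⟶ y.1) × (x.2 ⟶ y.2)))
  endo_eq_id _ _ := Prod.ext (hA.endo_eq_id _ _) (hB.endo_eq_id _ _)

lemma IsFiniteCategory.of_faithful {A B : Type w} [SmallCategory A] [SmallCategory B]
    (hA : Finite A) (hB : IsFiniteCategory B) (F : A ⥤ B) [F.Faithful] : IsFiniteCategory A where
  finite_obj := hA
  finite_hom x y := have := hB.finite_hom (F.obj x) (F.obj y)
    Finite.of_injective F.map F.map_injective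
  endo_eq_id x f := F.map_injective (by rw [hB.endo_eq_id _ (F.map f), F.map_id])

lemma IsFiniteCategory.structuredArrow {A B : Type w} [SmallCategory A] [SmallCategory B]
    (hA : IsFiniteCategory A) (hB : IsFiniteCategory B) (u : A ⥤ B) (k : B) :
    IsFiniteCategory (StructuredArrow k u) := by
  refine hA.of_faithful ?_ (StructuredArrow.proj k u)
  have := hA.finite_obj
  have := fun a => hB.finite_hom k (u.obj a)
  refine Finite.of_injective (β := Σ a : A, (k ⟶ u.obj a)) (fun x => ⟨x.right, x.hom⟩) ?_
  rintro ⟨⟨⟨⟩⟩, x, f⟩ ⟨⟨⟨⟩⟩, y, g⟩ h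
  simp only [Sigma.mk.injEq] at h
  obtain ⟨rfl, h⟩ := h
  obtain rfl := eq_of_heq h
  rfl

variable [IsDiagramCategory 𝒟]

variable (𝒟) in
lemma isFiniteCategory_interval : IsFiniteCategory (Dia.interval 𝒟) := isFiniteCategory_of_thin _

variable (𝒟) in
lemma isFiniteCategory_corner : IsFiniteCategory (Dia.corner 𝒟) := by
  have : Finite (Dia.corner 𝒟) := Finite.of_injective (fun x => x.obj) fun x y h => by
      cases x; cases y; cases h; rfl
  exact isFiniteCategory_of_thin _

end Finite

namespace Prederivator

section
variable [IsDiagramCategory 𝒟] {D E : Prederivator.{w, v, u} 𝒟} [D.IsDerivator] [E.IsDerivator]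
  {L : D ⟶ E}

lemma IsLeftExact.of_commutesWithFiniteLimits (h : CommutesWithFiniteLimits L) :
    IsLeftExact L := by
  intro A B u hA hB
  refine commutesWithRan_of_pointwise L fun k => ⟨k, Iso.refl k, Dia.under u k,
    StructuredArrow.proj k u, underCell u k, ?_, h _ (hA.structuredArrow hB u k)⟩
  exact inferInstanceAs (𝟭 (StructuredArrow k u)).IsLeftAdjoint

end

/-! ### Coherent arrows inverted by a left exact morphism -/

section
variable [IsDiagramCategory 𝒟] {D E : Prederivator.{w, v, u} 𝒟}

/-- The projection `J × [1] ⥤ J` is left adjoint to the inclusion at `1`. -/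
noncomputable def fstAdj (J : Dia 𝒟) :
    CategoryTheory.Prod.fst J Interval.{w} ⊣ Prod.sectL J (⟨1⟩ : Interval.{w}) :=
  Adjunction.mkOfUnitCounit
    { unit := { app := fun x => (𝟙 x.1, homOfLE (Fin.le_last x.2.down))
                naturality := fun _ _ _ => Prod.ext
                  ((Category.comp_id _).trans (Category.id_comp _).symm) (Subsingleton.elim _ _) }
      counit := { app := fun x => 𝟙 x
                  naturality := fun _ _ _ =>
                    (Category.comp_id _).trans (Category.id_comp _).symm }
      left_triangle := by
        ext x
        exact (Category.id_comp _).trans (Category.comp_id _)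
      right_triangle := by
        exact NatTrans.ext (funext fun x => Prod.ext
          ((Category.id_comp (𝟙 x ≫ 𝟙 x)).trans (Category.id_comp (𝟙 x))) (Subsingleton.elim _ _)) }

/-- The transformation from the composite of the projection with the inclusion at `0`. -/
def fstCell (J : Dia 𝒟) :
    CategoryTheory.Prod.fst J Interval.{w} ⋙ Prod.sectL J (⟨0⟩ : Interval.{w}) ⟶
      𝟭 (J × Interval.{w}) where
  app x := (𝟙 x.1, homOfLE (Fin.zero_le x.2.down))
  naturality _ _ _ := Prod.ext
    ((Category.comp_id _).trans (Category.id_comp _).symm) (Subsingleton.elim _ _)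

lemma isIso_dia_pull_fst [D.IsDerivator] {J : Dia 𝒟} {W : D.cat (J.prod (Dia.interval 𝒟))}
    {W' : D.cat J} (e : (D.pull (J := J.prod (Dia.interval 𝒟))
      (CategoryTheory.Prod.fst J Interval.{w})).obj W' ≅ W) : IsIso (D.dia W) := by
  rw [isIso_dia_iff]
  intro j
  refine (isIso_iff_of_comm ((D.pull _).map e.hom) ((D.pull _).map e.hom)
    ((D.pullMap (pointHom (B := J.prod (Dia.interval 𝒟))
      (intervalArrow j))).naturality e.hom).symm).1 ?_
  refine (isIso_iff_of_comm _ _ (arr_valIso (A := J.prod (Dia.interval 𝒟))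
    (CategoryTheory.Prod.fst J Interval.{w}) W' (intervalArrow j))).2 ?_
  change IsIso (arr W' (𝟙 j))
  rw [arr_id]; infer_instance

lemma exists_iso_pull_fst [D.IsDerivator] {J : Dia 𝒟} (W : D.cat (J.prod (Dia.interval 𝒟)))
    (h : IsIso (D.dia W)) : ∃ W' : D.cat J, Nonempty ((D.pull (J := J.prod (Dia.interval 𝒟))
      (CategoryTheory.Prod.fst J Interval.{w})).obj W' ≅ W) := by
  refine ⟨(D.pull (K := J.prod (Dia.interval 𝒟)) (Prod.sectL J (⟨0⟩ : Interval.{w}))).obj W, ?_⟩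
  have h1 : IsIso ((D.pullMap (J := J.prod (Dia.interval 𝒟)) (K := J.prod (Dia.interval 𝒟))
      (fstCell J)).app W) := by
    rw [isIso_pullMap_app_iff]
    rintro ⟨j, ⟨i⟩⟩
    fin_cases i
    · change IsIso (arr (B := J.prod (Dia.interval 𝒟)) W (𝟙 _))
      rw [arr_id]; infer_instance
    · exact (isIso_dia_iff W).1 h j
  exact ⟨((D.pullComp (J := J.prod (Dia.interval 𝒟)) (M := J.prod (Dia.interval 𝒟))
    (CategoryTheory.Prod.fst J Interval.{w})
    (Prod.sectL J (⟨0⟩ : Interval.{w}))).symm.app W) ≪≫ asIso ((D.pullMap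
      (J := J.prod (Dia.interval 𝒟)) (K := J.prod (Dia.interval 𝒟)) (fstCell J)).app W) ≪≫
      (D.pullId (J.prod (Dia.interval 𝒟))).app W⟩

/-- Restriction along the projection from `J × [1]` is right Kan extension along the inclusion
at `1`, so it commutes with right Kan extensions. -/
lemma IsRan.isIso_dia [D.IsDerivator] {A B : Dia 𝒟} {u : A ⥤ B}
    {Z : D.cat (B.prod (Dia.interval 𝒟))} {Y : D.cat (A.prod (Dia.interval 𝒟))}
    {t : (D.pull (J := A.prod (Dia.interval 𝒟)) (K := B.prod (Dia.interval 𝒟))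
      (u.prod (𝟭 Interval.{w}))).obj Z ⟶ Y}
    (ht : IsRan (A := A.prod (Dia.interval 𝒟)) (B := B.prod (Dia.interval 𝒟))
      (u.prod (𝟭 Interval.{w})) t) (hY : IsIso (D.dia Y)) : IsIso (D.dia Z) := by
  obtain ⟨Y', ⟨e⟩⟩ := exists_iso_pull_fst Y hY
  rw [← IsRan.comp_iso_iff e.inv] at ht
  have h1 := (isRan_pullAdj (A := A.prod (Dia.interval 𝒟)) (fstAdj A) Y').paste_iff.2 ht
  have h2 := (D.isRan_ranCounit u Y').paste_iff.2
    (isRan_pullAdj (A := B.prod (Dia.interval 𝒟)) (fstAdj B) (D := D) ((D.ran u).obj Y'))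
  obtain ⟨i⟩ := IsRan.nonempty_iso h2 h1
  exact isIso_dia_pull_fst i

lemma IsLeftExact.localsClosedUnderFiniteRan [D.IsDerivator] [E.IsDerivator] {L : D ⟶ E}
    (h : IsLeftExact L) : LocalsClosedUnderFiniteRan L := by
  intro A B u hA hB X hX
  have h1 := (commutesWithRan_iff L).1 (h (A.prod (Dia.interval 𝒟)) (B.prod (Dia.interval 𝒟))
    (u.prod (𝟭 Interval.{w})) (hA.prod (isFiniteCategory_interval 𝒟))
    (hB.prod (isFiniteCategory_interval 𝒟))) _ (D.isRan_ranCounit _ X)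
  exact h1.isIso_dia hX

end

/-! ### Cartesian squares and finite right Kan extensions of inverted arrows -/

section
variable [IsDiagramCategory 𝒟] {D E : Prederivator.{w, v, u} 𝒟}

/-- The inclusion of the corner in the square. -/
abbrev cornerIncl : Dia.corner 𝒟 ⥤ Dia.square 𝒟 := cornerProperty.{w}.ι

lemma isCartesian_iff [D.HasKanExtensions] (X : D.cat (Dia.square 𝒟)) :
    D.IsCartesian X ↔ IsRan (B := Dia.square 𝒟) (cornerIncl (𝒟 := 𝒟))
      (𝟙 ((D.pull (K := Dia.square 𝒟) (cornerIncl (𝒟 := 𝒟))).obj X)) := by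
  rw [isRan_iff_isIso_homEquiv (D.ranAdj (K := Dia.square 𝒟) (cornerIncl (𝒟 := 𝒟))),
    Adjunction.homEquiv_id]
  rfl

lemma inverts_congr {L : D ⟶ E} {B : Dia 𝒟} [Quiver.IsThin B] {Z : D.cat B} {x y x' y' : B}
    (f : x ⟶ y) (g : x' ⟶ y') (hx : x = x') (hy : y = y') :
    Inverts L Z f ↔ Inverts L Z g := by
  subst hx hy
  rw [Subsingleton.elim f g]

variable (𝒟) in
/-- The functor `□ ⥤ □ × [1]`, `(a, b) ↦ ((a, b), a)`. -/
abbrev squareDiag : Dia.square 𝒟 ⥤ (Dia.square 𝒟).prod (Dia.interval 𝒟) :=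
  (𝟭 _).prod' (CategoryTheory.Prod.fst _ _)

variable (𝒟) in
/-- The functor `□ × [1] ⥤ □`, `((a, b), t) ↦ (a ⊔ t, b)`. -/
noncomputable abbrev squareSup : (Dia.square 𝒟).prod (Dia.interval 𝒟) ⥤ Dia.square 𝒟 :=
  thinFunctor (fun x => (x.1.1 ⊔ x.2, x.1.2)) fun _ _ f =>
    ⟨(homOfLE (sup_le_sup f.1.1.le f.2.le), f.1.2)⟩

variable (𝒟) in
/-- The functor `squareDiag` restricted to the corner. -/
abbrev cornerDiag : Dia.corner 𝒟 ⥤ (Dia.corner 𝒟).prod (Dia.interval 𝒟) :=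
  (𝟭 _).prod' (cornerProperty.{w}.ι ⋙ CategoryTheory.Prod.fst _ _)

variable (𝒟) in
/-- The functor `squareSup` restricted to the corner. -/
noncomputable abbrev cornerSup : (Dia.corner 𝒟).prod (Dia.interval 𝒟) ⥤ Dia.corner 𝒟 :=
  thinFunctor (fun x => ⟨(x.1.obj.1 ⊔ x.2, x.1.obj.2), fun h => x.1.property (Prod.ext
      (le_antisymm (le_sup_left.trans (congrArg Prod.fst h).le) (Fin.zero_le _))
      (show x.1.obj.2 = _ from (Prod.mk.inj h).2))⟩) fun _ _ f =>
    ⟨⟨(homOfLE (sup_le_sup f.1.hom.1.le f.2.le), f.1.hom.2)⟩⟩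

variable (𝒟) in
/-- The functor `((a, b), t) ↦ (a ⊔ t, b)` is left adjoint to `(a, b) ↦ ((a, b), a)`. -/
noncomputable def squareAdj : squareSup 𝒟 ⊣ squareDiag 𝒟 :=
  thinAdjunction _ _ fun x y => by
    simp only [nonempty_hom_prod, thinFunctor_obj, Functor.prod'_obj, Functor.id_obj,
      CategoryTheory.Prod.fst_obj, nonempty_hom_chain, ULift.down_sup, sup_le_iff]
    tauto

variable (𝒟) in
/-- The adjunction `squareAdj` restricted to the corner. -/
noncomputable def cornerAdj : cornerSup 𝒟 ⊣ cornerDiag 𝒟 :=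
  thinAdjunction _ _ fun x y => by
    simp only [nonempty_hom_prod, nonempty_hom_fullSubcategory, thinFunctor_obj,
      Functor.prod'_obj, Functor.id_obj, Functor.comp_obj, ObjectProperty.ι_obj,
      CategoryTheory.Prod.fst_obj, nonempty_hom_chain, ULift.down_sup, sup_le_iff]
    tauto

/-- Regarded as a coherent arrow between its rows, a cartesian square is a right Kan extension in
`D^[1]` of its restriction to the corner. -/
lemma LocalsClosedUnderFiniteRan.localsPullbackStable [D.IsDerivator] [E.IsDerivator] {L : D ⟶ E}
    (h : LocalsClosedUnderFiniteRan L) : LocalsPullbackStable L := by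
  intro X hX hX'
  rw [isCartesian_iff] at hX
  rw [locals_edge_iff] at hX' ⊢
  set Y := (D.pull (K := Dia.square 𝒟) (cornerIncl (𝒟 := 𝒟))).obj X
  have h1 := hX.paste_iff.2 (isRan_pullAdj (A := (Dia.square 𝒟).prod (Dia.interval 𝒟))
    (B := Dia.square 𝒟) (squareAdj 𝒟) X)
  have h2 := (isRan_pullAdj (A := (Dia.corner 𝒟).prod (Dia.interval 𝒟))
    (B := Dia.corner 𝒟) (cornerAdj 𝒟) Y).paste_iff.2
    (D.isRan_ranCounit (A := (Dia.corner 𝒟).prod (Dia.interval 𝒟))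
      (B := (Dia.square 𝒟).prod (Dia.interval 𝒟))
      (cornerProperty.{w}.ι.prod (𝟭 Interval.{w})) _)
  -- The composites `corner ⥤ □ ⥤ □ × [1]` and `corner ⥤ corner × [1] ⥤ □ × [1]` agree, so both
  -- `h1` and `h2` are extensions of `Y` along the same functor.
  obtain ⟨e⟩ := IsRan.nonempty_iso h2 h1
  have h3 := h (Dia.corner 𝒟) (Dia.square 𝒟) (cornerIncl (𝒟 := 𝒟)) (isFiniteCategory_corner 𝒟)
    (isFiniteCategory_of_thin _) ((D.pull (J := (Dia.corner 𝒟).prod (Dia.interval 𝒟))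
      (cornerSup 𝒟)).obj Y) ?_
  · rw [locals_iff] at h3
    have h4 := (h3 (⟨0⟩, ⟨0⟩)).of_iso e
    rw [inverts_pull_iff (A := (Dia.square 𝒟).prod (Dia.interval 𝒟)) (B := Dia.square 𝒟)] at h4
    exact (inverts_congr (B := Dia.square 𝒟) _ _ rfl rfl).1 h4
  · rw [locals_iff]
    intro j
    -- At `(0, 1)` the arrow is the given edge, at `(1, b)` it is an identity.
    rw [inverts_pull_iff (A := (Dia.corner 𝒟).prod (Dia.interval 𝒟)),
      inverts_pull_iff (B := Dia.square 𝒟)]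
    obtain ⟨⟨⟨a⟩, ⟨b⟩⟩, hj⟩ := j
    fin_cases a
    · fin_cases b
      · exact absurd rfl hj
      · exact (inverts_congr (B := Dia.square 𝒟) _ _ rfl rfl).1 hX'
    · exact (inverts_congr (B := Dia.square 𝒟) _ _ rfl rfl).1
        (Inverts.id (B := Dia.square 𝒟) X (⟨1⟩, ⟨b⟩))

end

/-! ### Right Kan extensions along fully faithful functors and over empty diagrams -/

section
variable [IsDiagramCategory 𝒟] {D E : Prederivator.{w, v, u} 𝒟} {A B : Dia 𝒟}

lemma isLeftAdjoint_of_isInitial {C : Type*} [Category* C] (F : Discrete PUnit.{w + 1} ⥤ C)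
    (h : Limits.IsInitial (F.obj ⟨⟨⟩⟩)) : F.IsLeftAdjoint :=
  ⟨Functor.star C, ⟨Adjunction.mkOfHomEquiv
    { homEquiv _ Y := ⟨fun _ => eqToHom (Subsingleton.elim _ _), fun _ => h.to Y,
        fun _ => h.hom_ext _ _, fun _ => Subsingleton.elim _ _⟩
      homEquiv_naturality_left_symm _ _ := h.hom_ext _ _
      homEquiv_naturality_right _ _ := Subsingleton.elim _ _ }⟩⟩

omit [IsDiagramCategory 𝒟] in
lemma IsRan.isIso_of_iso_id {u : A ⥤ A} (α : u ≅ 𝟭 A) {Z Y : D.cat A} {t : (D.pull u).obj Z ⟶ Y}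
    (h : IsRan u t) : IsIso t := by
  have h1 := (IsRan.cell_iff α.inv).2 h
  have h2 : IsRan (𝟭 A) ((D.pullId A).hom.app Y) := isRan_id _
  obtain ⟨a, ha⟩ := h2.exists_lift ((D.pullMap α.inv).app Z ≫ t)
  have := h1.isIso' h2 a ha
  have h3 : IsIso ((D.pullMap α.inv).app Z ≫ t) := by rw [← ha]; infer_instance
  have := isIso_pullMap_app α.inv Z
  exact IsIso.of_isIso_comp_left ((D.pullMap α.inv).app Z) t

/-- The value of a limit cone at a point where the comma category has an initial object. -/
lemma IsRan.isIso_pull_point [D.IsDerivator] {u : A ⥤ B} {Z : D.cat B} {Y : D.cat A}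
    {t : (D.pull u).obj Z ⟶ Y} (h : IsRan u t) {k : B} {a : A} (f : k ≅ u.obj a)
    (hf : Limits.IsInitial (StructuredArrow.mk f.hom)) :
    IsIso ((D.pull (Dia.point a)).map t) := by
  let α : (Dia.pt 𝒟).toPt ⋙ Dia.point k ⟶ Dia.point a ⋙ u :=
    { app := fun _ => f.hom
      naturality := fun _ _ _ => (Category.id_comp f.hom).trans
        ((Category.comp_id f.hom).symm.trans (congrArg (f.hom ≫ ·) (u.map_id a).symm)) }
  have : IsIso α :=
    @NatIso.isIso_of_isIso_app _ _ _ _ _ _ _ fun x => inferInstanceAs (IsIso f.hom)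
  have h1 := (h.baseChange α (isLeftAdjoint_of_isInitial _ hf)).isIso_of_iso_id (Iso.refl _)
  have h2 := isIso_pullMap_app (D := D) α Z
  unfold Prederivator.baseChange at h1
  have h3 := @IsIso.of_isIso_comp_left _ _ _ _ _ _ _
    (Iso.isIso_hom ((D.pullComp (Dia.pt 𝒟).toPt (Dia.point k)).symm.app Z)) h1
  have h3 := @IsIso.of_isIso_comp_left _ _ _ _ _ _ _ h2 h3
  exact @IsIso.of_isIso_comp_left _ _ _ _ _ _ _
    (Iso.isIso_hom ((D.pullComp (Dia.point a) u).app Z)) h3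

lemma IsRan.isIso_of_full_of_faithful [D.IsDerivator] {u : A ⥤ B} [u.Full] [u.Faithful]
    {Z : D.cat B} {Y : D.cat A} {t : (D.pull u).obj Z ⟶ Y} (h : IsRan u t) : IsIso t :=
  IsDerivator.isIso_of_pointwise _ fun a =>
    h.isIso_pull_point (Iso.refl (u.obj a)) StructuredArrow.mkIdInitial

lemma isIso_of_isEmpty [D.IsDerivator] [IsEmpty A] {X Y : D.cat A} (f : X ⟶ Y) : IsIso f := by
  have := IsDerivator.empty (D := D) A
  exact isIso_of_reflects_iso f (Functor.star.{w} (D.cat A))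

variable {L : D ⟶ E} {R : E ⟶ D} (adj : Bicategory.Adjunction L R)

lemma isLocal_of_isEmpty [D.IsDerivator] [IsEmpty A] (Z : D.cat A) : IsLocal adj Z :=
  isIso_of_isEmpty _

/-- The value of a right Kan extension at an object outside the image of a sieve is terminal,
hence local. -/
lemma IsRan.isLocal_point [D.IsDerivator] (hadj : IsReflection adj) {u : A ⥤ B} {Z : D.cat B}
    {Y : D.cat A} {t : (D.pull u).obj Z ⟶ Y} (h : IsRan u t) (k : B)
    [IsEmpty (StructuredArrow k u)] : IsLocal adj ((D.pull (Dia.point k)).obj Z) := by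
  have h1 := h.baseChange (M := Dia.under u k) (underCell u k)
    (inferInstanceAs (𝟭 (StructuredArrow k u)).IsLeftAdjoint)
  have : IsEmpty (Dia.under u k) := ‹IsEmpty (StructuredArrow k u)›
  exact h1.isLocal adj hadj (isLocal_of_isEmpty adj _)

lemma locals_iff_isIso_map_dia {J : Dia 𝒟} (X : D.cat (J.prod (Dia.interval 𝒟))) :
    (locals L).prop (op J) X ↔ IsIso ((fn L J).map (D.dia X)) := by
  have h := natIso_pullMap L (A := J) (B := J.prod (Dia.interval 𝒟)) (intervalCell J) X
  exact (isIso_iff_of_comm _ _ h).symm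

end

/-! ### Choric resolutions -/

section
variable [IsDiagramCategory 𝒟] {D E : Prederivator.{w, v, u} 𝒟} {L : D ⟶ E} {R : E ⟶ D}
  (adj : Bicategory.Adjunction L R)

variable (D) in
/-- The restriction of a coherent arrow to its source (`i = 0`) or target (`i = 1`). -/
abbrev ends (J : Dia 𝒟) (i : Interval.{w}) : D.cat (J.prod (Dia.interval 𝒟)) ⥤ D.cat J :=
  D.pull (K := J.prod (Dia.interval 𝒟)) (Prod.sectL J i)

lemma chr_iff (hadj : IsReflection adj) {A : Dia 𝒟} (C : D.cat (A.prod (Dia.interval 𝒟))) :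
    (chr R).prop (op A) C ↔ IsLocal adj ((ends D A ⟨1⟩).obj C) :=
  (isLocal_iff_mem_essImage adj hadj _).symm

/-- The universal property of the left adjoint of `R♯`. -/
lemma exists_universal_chr (h : Bicategory.IsRightAdjoint (sharp R)) {A : Dia 𝒟} (Y : D.cat A) :
    ∃ (C : D.cat (A.prod (Dia.interval 𝒟))) (η : Y ⟶ (ends D A ⟨0⟩).obj C),
      (chr R).prop (op A) C ∧ ∀ C', (chr R).prop (op A) C' →
        Function.Bijective fun g : C ⟶ C' => η ≫ (ends D A ⟨0⟩).map g := by
  obtain ⟨⟨ℓ, a⟩⟩ := h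
  refine ⟨((fn ℓ A).obj Y).obj, unitAt a Y, ((fn ℓ A).obj Y).property, fun C' hC' => ?_⟩
  let C'' : ((chr R).prop (op A)).FullSubcategory := ⟨C', hC'⟩
  have h1 := ((adjAt a A).homEquiv Y C'').bijective
  have h2 := (ObjectProperty.fullyFaithfulι ((chr R).prop (op A))).homEquiv
    (X := (fn ℓ A).obj Y) (Y := C'') |>.symm.bijective
  refine (iff_of_eq (congrArg _ (funext fun g => ?_))).1 (h1.comp h2)
  exact (adjAt a A).homEquiv_unit _ _ _

lemma isIso_fstAdj_counit [D.IsDerivator] {A : Dia 𝒟} (Z : D.cat A) :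
    IsIso ((D.pullAdj (J := A.prod (Dia.interval 𝒟)) (fstAdj A)).counit.app Z) := by
  have h := isRan_pullAdj (D := D) (A := A.prod (Dia.interval 𝒟)) (fstAdj A) Z
  have : (Prod.sectL A (⟨1⟩ : Interval.{w})).Full := ⟨fun f => ⟨f.1, Prod.ext rfl rfl⟩⟩
  have : (Prod.sectL A (⟨1⟩ : Interval.{w})).Faithful := ⟨fun h => congrArg Prod.fst h⟩
  exact h.isIso_of_full_of_faithful (B := A.prod (Dia.interval 𝒟))

/-- A choric resolution: every object is, up to isomorphism, the source of a coherent arrow which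
is inverted by the reflection and whose target is local. The unit of the left adjoint of `R♯` is
invertible, as one sees by mapping into the right Kan extensions along the inclusion at `0`; it is
inverted by the reflection after passing to the target, as one sees by mapping into the constant
coherent arrows on local objects. -/
theorem exists_resolution [D.IsDerivator] (h : IsChoricReflection adj) {A : Dia 𝒟} (Y : D.cat A) :
    ∃ C : D.cat (A.prod (Dia.interval 𝒟)), (locals L).prop (op A) C ∧
      IsLocal adj ((ends D A ⟨1⟩).obj C) ∧ Nonempty (Y ≅ (ends D A ⟨0⟩).obj C) := by
  have hadj := h.isReflection
  obtain ⟨C, η, hC, hη⟩ := exists_universal_chr h.isRightAdjoint_sharp Y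
  rw [chr_iff adj hadj] at hC
  have h1 : IsIso η := by
    rw [isIso_iff_coyoneda_map_bijective]
    intro W
    -- Test against the extension of `W` by a terminal target, which belongs to `Chr`.
    have hr := D.isRan_ranCounit (B := A.prod (Dia.interval 𝒟))
      (Prod.sectL A (⟨0⟩ : Interval.{w})) W
    have : (Prod.sectL A (⟨0⟩ : Interval.{w})).Full := ⟨fun f => ⟨f.1, Prod.ext rfl rfl⟩⟩
    have : (Prod.sectL A (⟨0⟩ : Interval.{w})).Faithful := ⟨fun h => congrArg Prod.fst h⟩
    have hi := hr.isIso_of_full_of_faithful (B := A.prod (Dia.interval 𝒟))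
    have h2 := hη ((D.ran (K := A.prod (Dia.interval 𝒟)) (Prod.sectL A ⟨0⟩)).obj W) <| by
      rw [chr_iff adj hadj]
      refine isLocal_of_pointwise adj fun a => ?_
      have : IsEmpty (StructuredArrow (C := A) (D := A × Interval.{w}) (a, ⟨1⟩)
          (Prod.sectL A ⟨0⟩)) :=
        ⟨fun x => absurd x.hom.2.le (by simp)⟩
      exact isLocal_of_iso adj hadj (valIso _ _ _).symm
        (hr.isLocal_point adj hadj (B := A.prod (Dia.interval 𝒟)) (a, ⟨1⟩))
    rw [← (hr C).of_comp_iff]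
    refine (iff_of_eq (congrArg _ (funext fun g => ?_))).1
      ((asIso (D.ranCounit (B := A.prod (Dia.interval 𝒟)) (Prod.sectL A ⟨0⟩) W)).homToEquiv
        (Z := Y) |>.bijective.comp h2)
    exact Category.assoc _ _ _
  refine ⟨C, ?_, hC, ⟨asIso η⟩⟩
  have h2 : IsIso ((fn L A).map (η ≫ D.dia C)) := by
    refine isIso_map_of_bijective adj hadj _ fun Z hZ => ?_
    -- Test against the constant coherent arrow on `Z`, which belongs to `Chr`.
    have hi := isIso_fstAdj_counit Z
    have hd := isIso_dia_pull_fst (Iso.refl ((D.pull (J := A.prod (Dia.interval 𝒟))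
      (CategoryTheory.Prod.fst A Interval.{w})).obj Z))
    have h3 := hη ((D.pull (J := A.prod (Dia.interval 𝒟))
      (CategoryTheory.Prod.fst A Interval.{w})).obj Z) <| by
      rw [chr_iff adj hadj]
      exact isLocal_of_iso adj hadj (asIso ((D.pullAdj (J := A.prod (Dia.interval 𝒟))
        (fstAdj A)).counit.app Z)).symm hZ
    have hr := isRan_pullAdj (D := D) (A := A.prod (Dia.interval 𝒟)) (fstAdj A) Z
    rw [← (hr C).of_comp_iff]
    refine (iff_of_eq (congrArg _ (funext fun g => ?_))).1 (((asIso (D.dia _)).trans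
      (asIso ((D.pullAdj (J := A.prod (Dia.interval 𝒟)) (fstAdj A)).counit.app Z))).homToEquiv
        (Z := Y) |>.bijective.comp h3)
    have hn : (ends D A ⟨0⟩).map g ≫ D.dia _ = D.dia C ≫ (ends D A ⟨1⟩).map g :=
      (D.pullMap (K := A.prod (Dia.interval 𝒟)) (intervalCell A)).naturality g
    simp only [Function.comp_apply, Iso.homToEquiv_apply, Iso.trans_hom, asIso_hom,
      Category.assoc]
    rw [reassoc_of% hn]
  rw [locals_iff_isIso_map_dia]
  rw [Functor.map_comp] at h2
  exact IsIso.of_isIso_comp_left ((fn L A).map η) _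

end

/-! ### Exact squares -/

section
variable {D : Prederivator.{w, v, u} 𝒟} {A B M P M' P' : Dia 𝒟}
variable {u : A ⥤ B} {Z : D.cat B} {Y : D.cat A}

/-- Pasting of base changes. -/
lemma baseChange_baseChange {q : M ⥤ P} {κ : P ⥤ B} {m : M ⥤ A} (α : q ⋙ κ ⟶ m ⋙ u)
    {q' : M' ⥤ P'} {κ' : P' ⥤ P} {m' : M' ⥤ M} (α' : q' ⋙ κ' ⟶ m' ⋙ q)
    (t : (D.pull u).obj Z ⟶ Y) :
    (D.pull q').map ((D.pullComp κ' κ).hom.app Z) ≫ baseChange α' (baseChange α t) =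
      baseChange (κ := κ' ⋙ κ) (m := m' ⋙ m)
        ((Functor.whiskerRight α' κ ≫ Functor.whiskerLeft m' α :)) t ≫
        (D.pullComp m' m).hom.app Y := by
  have h1 := (D.pullComp m' m).hom.naturality t
  simp only [baseChange, Category.assoc, Functor.map_comp]
  rw [pullMap_app_comp, Category.assoc]
  erw [h1, reassoc_of% D.pullComp_assoc_inv]
  erw [← reassoc_of% D.pullMap_whiskerRight, reassoc_of% D.pullComp_assoc_inv',
    Iso.hom_inv_id_app_assoc, ← reassoc_of% D.pullMap_whiskerLeft, ← reassoc_of% D.pullComp_assoc]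
  rfl

lemma map_pullMap_baseChange {q : M ⥤ P} {κ κ' : P ⥤ B} {m : M ⥤ A} (e : κ' ⟶ κ)
    (α : q ⋙ κ ⟶ m ⋙ u) (t : (D.pull u).obj Z ⟶ Y) :
    (D.pull q).map ((D.pullMap e).app Z) ≫ baseChange α t =
      baseChange (Functor.whiskerLeft q e ≫ α) t := by
  simp only [baseChange]
  rw [pullMap_app_comp, Category.assoc, reassoc_of% pullComp_inv_whiskerLeft]

section
variable [IsDiagramCategory 𝒟]

/-- The cell over the comma category `(p / q)` obtained by pasting its comma square to a given
square. -/
def underPaste {q : M ⥤ P} {κ : P ⥤ B} {m : M ⥤ A} (γ : q ⋙ κ ⟶ m ⋙ u) (p : P) :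
    (Dia.under q p).toPt ⋙ Dia.point (κ.obj p) ⟶ (StructuredArrow.proj p q ⋙ m) ⋙ u :=
  Functor.whiskerLeft (Dia.under q p).toPt (pointCell κ p).inv ≫
    (Functor.whiskerRight (underCell.{w} q p) κ ≫
      Functor.whiskerLeft (StructuredArrow.proj p q) γ :)

/-- Right Kan extensions are compatible with base change along a square for which the induced
functors between comma categories are left adjoints. -/
lemma IsRan.baseChange_of_forall [D.IsDerivator] {t : (D.pull u).obj Z ⟶ Y} (h : IsRan u t)
    {q : M ⥤ P} {κ : P ⥤ B} {m : M ⥤ A} (γ : q ⋙ κ ⟶ m ⋙ u)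
    (hγ : ∀ p, (toUnder (M := Dia.under q p) (underPaste γ p)).IsLeftAdjoint) :
    IsRan q (Prederivator.baseChange γ t) := by
  refine isRan_of_pointwise fun p => ⟨p, Iso.refl p, Dia.under q p, StructuredArrow.proj p q,
    underCell q p, inferInstanceAs (𝟭 (StructuredArrow p q)).IsLeftAdjoint, ?_⟩
  have h1 := h.baseChange (M := Dia.under q p) (underPaste γ p) (hγ p)
  unfold underPaste at h1
  have := isIso_pullMap_app (D := D) (pointCell κ p).inv Z
  rw [← map_pullMap_baseChange (M := Dia.under q p), IsRan.iso_comp_iff,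
    ← IsRan.comp_iso_iff ((D.pullComp (J := Dia.under q p)
      (StructuredArrow.proj p q) m).hom.app Y)] at h1
  erw [← baseChange_baseChange (M' := Dia.under q p)] at h1
  exact (IsRan.iso_comp_iff (A := Dia.under q p) ((D.pullComp _ κ).hom.app Z)).1 h1

/-- Extensions along a functor which factors through the corner are cartesian. -/
lemma isCartesian_of_isRan [D.IsDerivator] {N : Dia 𝒟} {χ : N ⥤ Dia.corner 𝒟}
    {X : D.cat (Dia.square 𝒟)} {Y : D.cat N}
    {t : (D.pull (K := Dia.square 𝒟) (χ ⋙ cornerIncl (𝒟 := 𝒟))).obj X ⟶ Y}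
    (h : IsRan (B := Dia.square 𝒟) (χ ⋙ cornerIncl (𝒟 := 𝒟)) t) : D.IsCartesian X := by
  rw [isCartesian_iff]
  have h1 := D.isRan_ranCounit (B := Dia.square 𝒟) (cornerIncl (𝒟 := 𝒟)) ((D.ran χ).obj Y)
  have h2 := (D.isRan_ranCounit χ Y).paste_iff.2 h1
  obtain ⟨e⟩ := h.nonempty_iso h2
  have : (cornerIncl (𝒟 := 𝒟)).Full := inferInstanceAs cornerProperty.{w}.ι.Full
  have : (cornerIncl (𝒟 := 𝒟)).Faithful := inferInstanceAs cornerProperty.{w}.ι.Faithful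
  have h3 := h1.isIso_of_full_of_faithful
  refine (IsRan.iff_of_isIso (t' := D.ranCounit (B := Dia.square 𝒟) (cornerIncl (𝒟 := 𝒟))
    ((D.ran χ).obj Y)) e.hom ((D.pull _).map e.hom ≫ D.ranCounit (B := Dia.square 𝒟)
      (cornerIncl (𝒟 := 𝒟)) ((D.ran χ).obj Y)) ?_).2 h1
  rw [Category.id_comp]

end

end

end Prederivator
end Derivators

namespace Derivators

variable {𝒟 : ObjectProperty Cat.{w, w}}

/-! ### Cosieves of a finite poset -/

section
universe v₁ u₁ v₂ u₂ v₃ u₃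

instance {A : Type u₁} {B : Type u₂} [Category.{v₁} A] [Category.{v₂} B] [Quiver.IsThin A]
    (u : A ⥤ B) (k : B) : Quiver.IsThin (StructuredArrow k u) := fun _ _ =>
  ⟨fun _ _ => StructuredArrow.hom_ext _ _ (Subsingleton.elim _ _)⟩

lemma nonempty_hom_structuredArrow {A : Type u₁} {B : Type u₂} [Category.{v₁} A]
    [Category.{v₂} B] [Quiver.IsThin B] {u : A ⥤ B} {k : B} {x y : StructuredArrow k u} :
    Nonempty (x ⟶ y) ↔ Nonempty (x.right ⟶ y.right) :=
  ⟨fun ⟨f⟩ => ⟨f.right⟩, fun ⟨f⟩ => ⟨StructuredArrow.homMk f (Subsingleton.elim _ _)⟩⟩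

lemma isLeftAdjoint_of_thin {A : Type u₁} {B : Type u₂} [Category.{v₁} A] [Category.{v₂} B]
    [Quiver.IsThin A] [Quiver.IsThin B] (F : A ⥤ B) (G : B → A)
    (h : ∀ x y, Nonempty (F.obj x ⟶ y) ↔ Nonempty (x ⟶ G y)) : F.IsLeftAdjoint :=
  ⟨thinFunctor G fun x _ f => (h _ _).1 (((h _ _).2 ⟨𝟙 (G x)⟩).map (· ≫ f)),
    ⟨thinAdjunction F _ h⟩⟩

/-- The transformation between functors to a thin category with given components. -/
noncomputable def thinHom {A : Type u₁} {B : Type u₂} [Category.{v₁} A] [Category.{v₂} B]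
    [Quiver.IsThin B] {F G : A ⥤ B} (h : ∀ x, Nonempty (F.obj x ⟶ G.obj x)) : F ⟶ G where
  app x := (h x).some
  naturality _ _ _ := Subsingleton.elim _ _

end

/-- A cosieve of a category: a set of objects which contains the target of every arrow whose
source it contains. -/
@[ext]
structure Cosieve (B : Type w) [SmallCategory B] where
  carrier : Set B
  mem_of_hom ⦃x y : B⦄ : (x ⟶ y) → x ∈ carrier → y ∈ carrier

namespace Cosieve

variable {B : Type w} [SmallCategory B]

instance : Membership B (Cosieve B) := ⟨fun U x => x ∈ U.carrier⟩

lemma mem_ext {U V : Cosieve B} (h : ∀ x, x ∈ U ↔ x ∈ V) : U = V :=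
  Cosieve.ext (Set.ext h)

/-- Cosieves are ordered by reverse inclusion, so that an object is sent to the cosieve it
generates by a covariant functor. -/
instance : PartialOrder (Cosieve B) where
  le U V := ∀ x, x ∈ V → x ∈ U
  le_refl _ _ h := h
  le_trans _ _ _ h h' x hx := h x (h' x hx)
  le_antisymm _ _ h h' := mem_ext fun x => ⟨h' x, h x⟩

instance [Finite B] : Finite (Cosieve B) :=
  Finite.of_injective Cosieve.carrier fun _ _ => Cosieve.ext

lemma nonempty_hom {U V : Cosieve B} : Nonempty (U ⟶ V) ↔ ∀ x, x ∈ V → x ∈ U :=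
  ⟨fun ⟨f⟩ => f.le, fun h => ⟨homOfLE h⟩⟩

/-- The cosieve generated by an object. -/
def principal (x : B) : Cosieve B where
  carrier := {y | Nonempty (x ⟶ y)}
  mem_of_hom _ _ f := fun ⟨g⟩ => ⟨g ≫ f⟩

lemma mem_principal {x y : B} : y ∈ principal x ↔ Nonempty (x ⟶ y) := Iff.rfl

lemma nonempty_hom_principal {U : Cosieve B} {x : B} :
    Nonempty (U ⟶ principal x) ↔ x ∈ U := by
  rw [nonempty_hom]
  exact ⟨fun h => h x ⟨𝟙 x⟩, fun h _ ⟨f⟩ => U.mem_of_hom f h⟩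

variable (B) in
/-- The functor from a category to its cosieves, which sends an object to the cosieve it
generates. -/
noncomputable def principalFunctor : B ⥤ Cosieve B :=
  thinFunctor principal fun _ _ f => nonempty_hom_principal.2 ⟨f⟩

instance : (principalFunctor B).Full where
  map_surjective f := ⟨(nonempty_hom_principal.1 ⟨f⟩).some, Subsingleton.elim _ _⟩

instance [Quiver.IsThin B] : (principalFunctor B).Faithful where
  map_injective _ := Subsingleton.elim _ _

/-- The square with vertices `U ∪ V`, `U`, `V` and `U ∩ V`. -/
noncomputable def square (U V : Cosieve B) : Interval.{w} × Interval.{w} ⥤ Cosieve B :=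
  thinFunctor (fun c =>
    { carrier := {x | (x ∈ U ∨ x ∈ V) ∧ (c.1 = ⟨1⟩ → x ∈ U) ∧ (c.2 = ⟨1⟩ → x ∈ V)}
      mem_of_hom := fun _ _ f h => ⟨h.1.imp (U.mem_of_hom f) (V.mem_of_hom f),
        fun hc => U.mem_of_hom f (h.2.1 hc), fun hc => V.mem_of_hom f (h.2.2 hc)⟩ })
    fun _ d f => nonempty_hom.2 fun _ hx => ⟨hx.1,
      fun hc => hx.2.1 (le_antisymm (Fin.le_last d.1.down) (hc ▸ f.1.le)),
      fun hc => hx.2.2 (le_antisymm (Fin.le_last d.2.down) (hc ▸ f.2.le))⟩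

lemma mem_square {U V : Cosieve B} {c : Interval.{w} × Interval.{w}} {x : B} :
    x ∈ (square U V).obj c ↔ (x ∈ U ∨ x ∈ V) ∧ (c.1 = ⟨1⟩ → x ∈ U) ∧ (c.2 = ⟨1⟩ → x ∈ V) :=
  Iff.rfl

/-- The union of two cosieves, as a full subcategory. -/
abbrev unionProperty (U V : Cosieve B) : ObjectProperty B := fun x => x ∈ U ∨ x ∈ V

open Classical in
/-- The functor which sends an object of `U ∪ V` to the vertex of the square corresponding to the
smallest of `U`, `V` and `U ∩ V` containing it. -/
noncomputable def toCorner (U V : Cosieve B) :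
    (unionProperty U V).FullSubcategory ⥤ cornerProperty.{w}.FullSubcategory :=
  thinFunctor (fun x => ⟨(⟨if x.obj ∈ U then 1 else 0⟩, ⟨if x.obj ∈ V then 1 else 0⟩), fun h => by
      have h1 := congrArg ULift.down (Prod.mk.inj h).1
      have h2 := congrArg ULift.down (Prod.mk.inj h).2
      have := x.property
      simp_all [unionProperty]⟩) fun x y f => by
    have h1 : x.obj ∈ U → y.obj ∈ U := U.mem_of_hom f.hom
    have h2 : x.obj ∈ V → y.obj ∈ V := V.mem_of_hom f.hom
    simp only [nonempty_hom_fullSubcategory, nonempty_hom_prod, nonempty_hom_chain]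
    constructor <;> split_ifs <;> simp_all

open Classical in
lemma nonempty_hom_toCorner {U V : Cosieve B} {x : (unionProperty U V).FullSubcategory}
    {c : Interval.{w} × Interval.{w}} :
    Nonempty (c ⟶ ((toCorner U V).obj x).obj) ↔ x.obj ∈ (square U V).obj c := by
  obtain ⟨⟨a⟩, ⟨b⟩⟩ := c
  have := x.property
  rw [mem_square]
  simp only [nonempty_hom_prod, nonempty_hom_chain, toCorner, thinFunctor_obj]
  fin_cases a <;> fin_cases b <;> split_ifs <;> simp_all [unionProperty]

end Cosieve

end Derivators

namespace Derivators

variable {𝒟 : ObjectProperty Cat.{w, w}}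

/-! ### Limits over finite posets -/

namespace Cosieve
variable {B : Type w} [SmallCategory B]

/-- The empty cosieve. -/
def empty (B : Type w) [SmallCategory B] : Cosieve B := ⟨∅, fun _ _ _ h => h⟩

/-- The cosieve of all objects. -/
def all (B : Type w) [SmallCategory B] : Cosieve B := ⟨Set.univ, fun _ _ _ h => h⟩

lemma notMem_empty (x : B) : x ∉ empty B := fun h => h

lemma mem_all (x : B) : x ∈ all B := trivial

/-- The intersection of two cosieves. -/
def inter (U V : Cosieve B) : Cosieve B where
  carrier := {x | x ∈ U ∧ x ∈ V}
  mem_of_hom _ _ f h := ⟨U.mem_of_hom f h.1, V.mem_of_hom f h.2⟩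

lemma mem_inter {U V : Cosieve B} {x : B} : x ∈ U.inter V ↔ x ∈ U ∧ x ∈ V := Iff.rfl

/-- The cosieve obtained by removing a minimal object. -/
def erase (U : Cosieve B) (a : B) (ha : ∀ x ∈ U, (x ⟶ a) → x = a) : Cosieve B where
  carrier := {x | x ∈ U ∧ x ≠ a}
  mem_of_hom x _ f h := ⟨U.mem_of_hom f h.1, fun e => h.2 (ha x h.1 (f ≫ eqToHom e))⟩

lemma mem_erase {U : Cosieve B} {a : B} {ha : ∀ x ∈ U, (x ⟶ a) → x = a} {x : B} :
    x ∈ U.erase a ha ↔ x ∈ U ∧ x ≠ a := Iff.rfl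

/-- The cosieve `A × {0} ∪ Q × {1}` of `B × [1]`, for `A ⊆ Q`. -/
def cylinder (A Q : Cosieve B) : Cosieve (B × Interval.{w}) where
  carrier := {x | x.1 ∈ A ∨ x.2 = ⟨1⟩ ∧ x.1 ∈ Q}
  mem_of_hom x y f h := h.imp (A.mem_of_hom f.1) fun (h : x.2 = ⟨1⟩ ∧ x.1 ∈ Q) =>
    ⟨le_antisymm (Fin.le_last y.2.down) (h.1 ▸ f.2.le), Q.mem_of_hom f.1 h.2⟩

lemma mem_cylinder {A Q : Cosieve B} {x : B × Interval.{w}} :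
    x ∈ cylinder A Q ↔ x.1 ∈ A ∨ x.2 = ⟨1⟩ ∧ x.1 ∈ Q := Iff.rfl

lemma eq_one_iff {i : Interval.{w}} : i = ⟨1⟩ ↔ 1 ≤ i.down :=
  ⟨fun h => h ▸ le_rfl, fun h => le_antisymm (Fin.le_last i.down) h⟩

lemma principal_zero (a : B) :
    principal (B := B × Interval.{w}) (a, ⟨0⟩) = cylinder (principal a) (principal a) := by
  refine mem_ext fun x => ?_
  simp only [mem_principal, mem_cylinder, nonempty_hom_prod, nonempty_hom_chain]
  have : (0 : Fin 2) ≤ x.2.down := Fin.zero_le _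
  tauto

lemma principal_one (a : B) :
    principal (B := B × Interval.{w}) (a, ⟨1⟩) = cylinder (empty B) (principal a) := by
  refine mem_ext fun x => ?_
  simp only [mem_principal, mem_cylinder, nonempty_hom_prod, nonempty_hom_chain, eq_one_iff,
    notMem_empty]
  tauto

lemma exists_minimal [Finite B] [Quiver.IsThin B] (hB : Skeletal B) (U : Cosieve B) {b : B}
    (hb : b ∈ U) : ∃ a ∈ U, ∀ x ∈ U, (x ⟶ a) → x = a := by
  let : PartialOrder B :=
    { le x y := Nonempty (x ⟶ y)
      le_refl x := ⟨𝟙 x⟩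
      le_trans _ _ _ := fun ⟨f⟩ ⟨g⟩ => ⟨f ≫ g⟩
      le_antisymm x y := fun ⟨f⟩ ⟨g⟩ =>
        hB ⟨⟨f, g, Subsingleton.elim _ _, Subsingleton.elim _ _⟩⟩ }
  obtain ⟨a, ha⟩ := (Set.toFinite U.carrier).exists_minimal ⟨b, hb⟩
  exact ⟨a, ha.1, fun x hx f => le_antisymm (a := x) ⟨f⟩ (ha.2 hx ⟨f⟩)⟩

end Cosieve

open Cosieve

namespace Prederivator

section
variable [IsDiagramCategory 𝒟]

/-- The poset of cosieves of a finite diagram. -/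
abbrev Dia.cosieves (B : Dia 𝒟) [Finite B] : Dia 𝒟 := .mk (Cosieve B) (mem_of_partialOrder 𝒟 _)

lemma mem_fullSubcategory (B : Dia 𝒟) [Finite B] [Quiver.IsThin B] (hB : Skeletal B)
    (P : ObjectProperty B) : 𝒟 (Cat.of P.FullSubcategory) := by
  have : Finite P.FullSubcategory := Finite.of_injective (fun x => x.obj) fun x y h => by
    cases x; cases y; cases h; rfl
  refine IsDiagramCategory.finite_poset _ fun x y ⟨e⟩ => ?_
  have h : x.obj = y.obj := hB ⟨P.ι.mapIso e⟩
  cases x; cases y; cases h; rfl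

variable {D E : Prederivator.{w, v, u} 𝒟} [D.IsDerivator]

/-- The limits of a diagram over two cosieves, their union and their intersection form a cartesian
square. -/
lemma IsRan.isCartesian_square {B : Dia 𝒟} [Finite B] [Quiver.IsThin B] (hB : Skeletal B)
    {C : D.cat B} {Z : D.cat (Dia.cosieves B)}
    {t : (D.pull (K := Dia.cosieves B) (principalFunctor B)).obj Z ⟶ C}
    (ht : IsRan (B := Dia.cosieves B) (principalFunctor B) t) (U V : Cosieve B) :
    D.IsCartesian ((D.pull (J := Dia.square 𝒟) (K := Dia.cosieves B) (square U V)).obj Z) := by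
  let N : Dia 𝒟 := .mk (unionProperty U V).FullSubcategory (mem_fullSubcategory B hB _)
  let χ : N ⥤ Dia.corner 𝒟 := toCorner U V
  let γ : (χ ⋙ cornerIncl (𝒟 := 𝒟)) ⋙ square U V ⟶
      (unionProperty U V).ι ⋙ principalFunctor B :=
    thinHom fun x => nonempty_hom_principal.2 (nonempty_hom_toCorner.1 ⟨𝟙 _⟩)
  refine isCartesian_of_isRan (N := N) (χ := χ) (ht.baseChange_of_forall γ fun c => ?_)
  have hy (y : StructuredArrow ((square U V).obj c) (principalFunctor B)) :
      y.right ∈ (square U V).obj c := nonempty_hom_principal.1 ⟨y.hom⟩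
  refine isLeftAdjoint_of_thin _ (fun y => StructuredArrow.mk
    (Y := (⟨y.right, (hy y).1⟩ : (unionProperty U V).FullSubcategory))
    (nonempty_hom_toCorner.2 (hy y)).some) fun x y => ?_
  rw [nonempty_hom_structuredArrow, nonempty_hom_structuredArrow, nonempty_hom_fullSubcategory]
  rfl

lemma LocalsPullbackStable.inverts_inter [E.IsDerivator] {L : D ⟶ E}
    (hL : LocalsPullbackStable L) {B : Dia 𝒟} [Finite B] [Quiver.IsThin B] (hB : Skeletal B)
    {C : D.cat B} {Z : D.cat (Dia.cosieves B)}
    {t : (D.pull (K := Dia.cosieves B) (principalFunctor B)).obj Z ⟶ C}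
    (ht : IsRan (B := Dia.cosieves B) (principalFunctor B) t) {U V W I : Cosieve B}
    (hW : ∀ x, x ∈ W ↔ x ∈ U ∨ x ∈ V) (hI : ∀ x, x ∈ I ↔ x ∈ U ∧ x ∈ V)
    {f : V ⟶ I} (hf : Inverts (B := Dia.cosieves B) L Z f) (g : W ⟶ U) :
    Inverts (B := Dia.cosieves B) L Z g := by
  have h := hL _ (ht.isCartesian_square hB U V)
  rw [locals_edge_iff, locals_edge_iff, inverts_pull_iff (B := Dia.cosieves B),
    inverts_pull_iff (B := Dia.cosieves B)] at h
  refine (inverts_congr (B := Dia.cosieves B) _ _ ?_ ?_).1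
    (h ((inverts_congr (B := Dia.cosieves B) _ _ ?_ ?_).1 hf)) <;>
  · refine mem_ext fun x => ?_
    have h1 := hW x
    have h2 := hI x
    simp [mem_square]
    tauto

/-- If the coherent arrow `C` in `D(P)` is inverted by `L`, then so is the comparison of its limits
over `A × {0} ∪ Q × {1}` and over `Q × {1}`. The objects of `A` are removed one at a time, each
removal being the base change of a comparison over a smaller cosieve. -/
lemma LocalsPullbackStable.inverts_cylinder [E.IsDerivator] {L : D ⟶ E}
    (hL : LocalsPullbackStable L) {P : Dia 𝒟} [Finite P] [Quiver.IsThin P] (hP : Skeletal P)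
    (hP' : Skeletal (P × Interval.{w})) {C : D.cat (P.prod (Dia.interval 𝒟))}
    (hC : ∀ p : P, Inverts (B := P.prod (Dia.interval 𝒟)) L C (intervalArrow p))
    {Z : D.cat (Dia.cosieves (P.prod (Dia.interval 𝒟)))}
    {t : (D.pull (J := P.prod (Dia.interval 𝒟)) (K := Dia.cosieves (P.prod (Dia.interval 𝒟)))
      (principalFunctor (P × Interval.{w}))).obj Z ⟶ C}
    (ht : IsRan (A := P.prod (Dia.interval 𝒟)) (B := Dia.cosieves (P.prod (Dia.interval 𝒟)))
      (principalFunctor (P × Interval.{w})) t) (A Q : Cosieve P) (hA : ∀ x ∈ A, x ∈ Q)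
    (f : cylinder A Q ⟶ cylinder (empty P) Q) :
    Inverts (B := Dia.cosieves (P.prod (Dia.interval 𝒟))) L Z f := by
  induction hn : A.carrier.ncard using Nat.strong_induction_on generalizing A Q with
  | _ n ih =>
  by_cases hne : ∃ b, b ∈ A
  · obtain ⟨b, hb⟩ := hne
    obtain ⟨a, ha, hmin⟩ := A.exists_minimal hP hb
    have hlt : (A.erase a hmin).carrier.ncard < n := hn ▸ Set.ncard_lt_ncard
      ⟨fun _ (hx : _ ∧ _) => hx.1, fun h => (h ha).2 rfl⟩ (Set.toFinite _)
    have hlt' : ((principal a).inter (A.erase a hmin)).carrier.ncard < n :=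
      (Set.ncard_le_ncard (fun _ (hx : _ ∧ _) => hx.2) (Set.toFinite _)).trans_lt hlt
    obtain ⟨f₁⟩ : Nonempty (cylinder (A.erase a hmin) Q ⟶ cylinder (empty P) Q) :=
      Cosieve.nonempty_hom.2 fun x hx => hx.imp (fun h => absurd h (notMem_empty _)) id
    -- It remains to remove `(a, 0)`. This is a base change of the removal of `(a, 0)` from the
    -- cosieve it generates, which is `f₃`; here `f₃ ≫ f₂` corresponds to the arrow
    -- `C(a, 0) ⟶ C(a, 1)`.
    have h₁ := ih _ hlt (A.erase a hmin) Q (fun x hx => hA x (mem_erase.1 hx).1) f₁ rfl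
    obtain ⟨f₂⟩ : Nonempty (cylinder ((principal a).inter (A.erase a hmin)) (principal a) ⟶
        cylinder (empty P) (principal a)) :=
      Cosieve.nonempty_hom.2 fun x hx => hx.imp (fun h => absurd h (notMem_empty _)) id
    have h₂ := ih _ hlt' _ (principal a) (fun x hx => (mem_inter.1 hx).1) f₂ rfl
    obtain ⟨f₃⟩ : Nonempty (cylinder (principal a) (principal a) ⟶
        cylinder ((principal a).inter (A.erase a hmin)) (principal a)) :=
      Cosieve.nonempty_hom.2 fun x hx => hx.imp (fun h => h.1) id
    obtain ⟨f₄⟩ : Nonempty (cylinder A Q ⟶ cylinder (A.erase a hmin) Q) :=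
      Cosieve.nonempty_hom.2 fun x hx => hx.imp (fun h => h.1) id
    have h₃ : Inverts (B := Dia.cosieves (P.prod (Dia.interval 𝒟))) L Z (f₃ ≫ f₂) := by
      have := ht.isIso_of_full_of_faithful (A := P.prod (Dia.interval 𝒟))
        (B := Dia.cosieves (P.prod (Dia.interval 𝒟)))
      have h := (hC a).of_iso (asIso t).symm
      rw [inverts_pull_iff (A := P.prod (Dia.interval 𝒟))
        (B := Dia.cosieves (P.prod (Dia.interval 𝒟)))] at h
      exact (inverts_congr (B := Dia.cosieves (P.prod (Dia.interval 𝒟))) _ _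
        (principal_zero a) (principal_one a)).1 h
    have h₄ := LocalsPullbackStable.inverts_inter hL (B := P.prod (Dia.interval 𝒟)) hP' ht
      (U := cylinder (A.erase a hmin) Q)
      (V := cylinder (principal a) (principal a)) (W := cylinder A Q)
      (I := cylinder ((principal a).inter (A.erase a hmin)) (principal a)) (fun x => ?_)
      (fun x => ?_) (h₃.of_comp_right h₂) f₄
    · exact (inverts_congr (B := Dia.cosieves (P.prod (Dia.interval 𝒟))) _ _ rfl rfl).1
        (h₄.comp h₁)
    · have hx : x.1 ∈ principal a → x.1 ∈ A := fun ⟨g⟩ => A.mem_of_hom g ha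
      have hx' : x.1 = a → x.1 ∈ principal a := fun h => h ▸ ⟨𝟙 _⟩
      simp only [mem_cylinder, mem_erase]
      tauto
    · have hx : x.1 ∈ principal a → x.1 ∈ Q := fun ⟨g⟩ => hA _ (A.mem_of_hom g ha)
      simp only [mem_cylinder, mem_erase, mem_inter]
      tauto
  · obtain rfl : A = empty P := mem_ext fun x =>
      ⟨fun h => (hne ⟨x, h⟩).elim, fun h => (notMem_empty x h).elim⟩
    exact (inverts_congr (B := Dia.cosieves (P.prod (Dia.interval 𝒟))) _ _ rfl rfl).1
      (Inverts.id (B := Dia.cosieves (P.prod (Dia.interval 𝒟))) Z (cylinder (empty P) Q))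

end

end Prederivator

end Derivators

namespace Derivators

variable {𝒟 : ObjectProperty Cat.{w, w}}

open Cosieve

namespace Prederivator

lemma baseChange_pullMap {D : Prederivator.{w, v, u} 𝒟} {A B M P : Dia 𝒟}
    {u : A ⥤ B} {Z : D.cat B} {Y : D.cat A} {q : M ⥤ P} {κ : P ⥤ B} {m m' : M ⥤ A}
    (α : q ⋙ κ ⟶ m ⋙ u) (β : m ⟶ m') (t : (D.pull u).obj Z ⟶ Y) :
    baseChange α t ≫ (D.pullMap β).app Y =
      baseChange (m := m') (α ≫ Functor.whiskerRight β u) t := by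
  have h1 := (D.pullMap β).naturality t
  simp only [baseChange, Category.assoc]
  rw [pullMap_app_comp, Category.assoc]
  erw [h1, reassoc_of% D.pullMap_whiskerRight]

section
variable [IsDiagramCategory 𝒟] {D E : Prederivator.{w, v, u} 𝒟} [D.IsDerivator]

lemma skeletal_prod_interval {P : Type w} [SmallCategory P] (hP : Skeletal P) :
    Skeletal (P × Interval.{w}) := fun _ _ ⟨e⟩ =>
  Prod.ext (hP ⟨(CategoryTheory.Prod.fst _ _).mapIso e⟩) (le_antisymm e.hom.2.le e.inv.2.le)

/-- The limits of the ends of a coherent arrow inverted by `L` are compared by a morphism inverted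
by `L`. -/
lemma LocalsPullbackStable.exists_isRan [E.IsDerivator] {L : D ⟶ E}
    (hL : LocalsPullbackStable L) {P : Dia 𝒟} [Finite P] [Quiver.IsThin P] (hP : Skeletal P)
    {C : D.cat (P.prod (Dia.interval 𝒟))} (hC : (locals L).prop (op P) C) :
    ∃ (V₀ V₁ : D.cat (Dia.pt 𝒟)) (t₀ : (D.pull P.toPt).obj V₀ ⟶ (ends D P ⟨0⟩).obj C)
      (t₁ : (D.pull P.toPt).obj V₁ ⟶ (ends D P ⟨1⟩).obj C) (a : V₀ ⟶ V₁),
      IsRan P.toPt t₀ ∧ IsRan P.toPt t₁ ∧ (D.pull P.toPt).map a ≫ t₁ = t₀ ≫ D.dia C ∧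
        IsIso ((fn L _).map a) := by
  have ht := D.isRan_ranCounit (A := P.prod (Dia.interval 𝒟))
    (B := Dia.cosieves (P.prod (Dia.interval 𝒟))) (principalFunctor (P × Interval.{w})) C
  let α₀ : P.toPt ⋙ Dia.point (J := Dia.cosieves (P.prod (Dia.interval 𝒟)))
      (cylinder (Cosieve.all P) (Cosieve.all P)) ⟶
      Prod.sectL P (⟨0⟩ : Interval.{w}) ⋙ principalFunctor (P × Interval.{w}) :=
    thinHom fun x => nonempty_hom_principal.2 (Or.inl (mem_all x))
  let α₁ : P.toPt ⋙ Dia.point (J := Dia.cosieves (P.prod (Dia.interval 𝒟)))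
      (cylinder (Cosieve.empty P) (Cosieve.all P)) ⟶
      Prod.sectL P (⟨1⟩ : Interval.{w}) ⋙ principalFunctor (P × Interval.{w}) :=
    thinHom fun x => nonempty_hom_principal.2 (Or.inr ⟨rfl, mem_all x⟩)
  obtain ⟨f⟩ : Nonempty (cylinder (Cosieve.all P) (Cosieve.all P) ⟶
      cylinder (Cosieve.empty P) (Cosieve.all P)) :=
    Cosieve.nonempty_hom.2 fun x _ => Or.inl (mem_all x.1)
  refine ⟨_, _, _, _, arr (B := Dia.cosieves (P.prod (Dia.interval 𝒟))) _ f,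
    ht.baseChange (A := P.prod (Dia.interval 𝒟))
      (B := Dia.cosieves (P.prod (Dia.interval 𝒟))) α₀ ?_,
    ht.baseChange (A := P.prod (Dia.interval 𝒟))
      (B := Dia.cosieves (P.prod (Dia.interval 𝒟))) α₁ ?_, ?_, ?_⟩
  · refine isLeftAdjoint_of_thin _ (fun y => y.right.1) fun x y => ?_
    rw [nonempty_hom_structuredArrow, toUnder_obj, StructuredArrow.mk_right, nonempty_hom_prod]
    exact and_iff_left (nonempty_hom_chain.2 (Fin.zero_le _))
  · refine isLeftAdjoint_of_thin _ (fun y => y.right.1) fun x y => ?_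
    have hy := mem_cylinder.1 (nonempty_hom_principal.1 ⟨y.hom⟩)
    rw [nonempty_hom_structuredArrow, toUnder_obj, StructuredArrow.mk_right, nonempty_hom_prod]
    exact and_iff_left (nonempty_hom_chain.2 (eq_one_iff.1
      (hy.resolve_left (notMem_empty _)).1))
  · refine (map_pullMap_baseChange _ _ _).trans (Eq.trans ?_ (baseChange_pullMap
      (A := P.prod (Dia.interval 𝒟)) (B := Dia.cosieves (P.prod (Dia.interval 𝒟))) α₀
      (intervalCell P) _).symm)
    exact congrArg (fun α => baseChange (A := P.prod (Dia.interval 𝒟))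
      (B := Dia.cosieves (P.prod (Dia.interval 𝒟))) α _)
      (NatTrans.ext (funext fun x => Subsingleton.elim _ _))
  · exact LocalsPullbackStable.inverts_cylinder hL hP (skeletal_prod_interval hP)
      ((locals_iff C).1 hC) ht _ _ (fun _ h => h) f

/-- A reflection with choric resolutions commutes with limits over finite posets, because limits of
local objects are preserved. -/
lemma LocalsPullbackStable.commutesWithRan_of_poset [E.IsDerivator] {L : D ⟶ E} {R : E ⟶ D}
    (adj : Bicategory.Adjunction L R) (hadj : IsChoricReflection adj)
    (hL : LocalsPullbackStable L) {P : Dia 𝒟} [Finite P] [Quiver.IsThin P] (hP : Skeletal P) :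
    CommutesWithRan L P.toPt := by
  rw [commutesWithRan_iff]
  intro Z Y t ht
  obtain ⟨C, hC, hC₁, ⟨e⟩⟩ := exists_resolution adj hadj Y
  obtain ⟨V₀, V₁, t₀, t₁, a, ht₀, ht₁, ha, haL⟩ := LocalsPullbackStable.exists_isRan hL hP hC
  obtain ⟨b, hb⟩ := ht₀.exists_lift (t ≫ e.hom)
  have := ht.isIso ht₀ b e.hom hb
  exact (IsRan.iff_of_isIso _ _ (mapCone_naturality L b e.hom hb)).2
    (IsRan.mapCone_of_compare adj hadj.isReflection ht₁ hC₁ a _ ha haL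
      ((locals_iff_isIso_map_dia C).1 hC))

end

end Prederivator

end Derivators

namespace Derivators

variable {𝒟 : ObjectProperty Cat.{w, w}}

/-! ### Resolution of finite categories by finite posets -/

section
variable {A : Type w} [SmallCategory A]

/-- A star at an object `x`: a set of arrows out of `x` which contains the identity and in which
each target occurs at most once. -/
@[ext]
structure Star (x : A) where
  arrows : Set (Σ y, x ⟶ y)
  id_mem : ⟨x, 𝟙 x⟩ ∈ arrows
  eq_of_fst_eq : ∀ s ∈ arrows, ∀ s' ∈ arrows, s.1 = s'.1 → s = s'

namespace Star

/-- Stars are ordered by reverse inclusion. -/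
instance (x : A) : PartialOrder (Star x) where
  le S S' := S'.arrows ⊆ S.arrows
  le_refl _ := subset_rfl
  le_trans _ _ _ h h' := h'.trans h
  le_antisymm _ _ h h' := Star.ext (h'.antisymm h)

lemma finite (hA : IsFiniteCategory A) (x : A) : Finite (Star x) := by
  have := hA.finite_obj
  have := hA.finite_hom x
  exact Finite.of_injective Star.arrows fun _ _ => Star.ext

/-- The star consisting of the identity alone. -/
def trivial (x : A) : Star x where
  arrows := {⟨x, 𝟙 x⟩}
  id_mem := rfl
  eq_of_fst_eq := fun _ h _ h' _ => h.trans h'.symm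

lemma le_trivial {x : A} (S : Star x) : S ≤ trivial x := Set.singleton_subset_iff.2 S.id_mem

/-- The star at `x` obtained from a star at `y` by composition with an arrow `x ⟶ y` and addition
of the identity. -/
def prepend (hA : IsFiniteCategory A) {x y : A} (f : x ⟶ y) (S : Star y) : Star x where
  arrows := {s | s = ⟨x, 𝟙 x⟩ ∨ ∃ s' ∈ S.arrows, s = ⟨s'.1, f ≫ s'.2⟩}
  id_mem := Or.inl rfl
  eq_of_fst_eq := by
    have key (s : Σ y, x ⟶ y) (h : s.1 = x) : s = ⟨x, 𝟙 x⟩ := by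
      obtain ⟨z, g⟩ := s
      obtain rfl : z = x := h
      rw [hA.endo_eq_id _ g]
    rintro s (rfl | ⟨r, hr, rfl⟩) s' hs' h
    · exact (key s' h.symm).symm
    · rcases hs' with rfl | ⟨r', hr', rfl⟩
      · exact key _ h
      · rw [S.eq_of_fst_eq r hr r' hr' h]

end Star

/-- The objects of the category resolving `A`: stars at the objects of a given set `T`. -/
structure StarAt (T : Set A) where
  root : A
  root_mem : root ∈ T
  star : Star root

namespace StarAt
variable {T : Set A}

/-- A morphism between stars is an arrow between their roots, composition with which sends the
target into the source. -/
instance : SmallCategory (StarAt T) where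
  Hom σ τ := {g : σ.root ⟶ τ.root // ∀ s ∈ τ.star.arrows, ⟨s.1, g ≫ s.2⟩ ∈ σ.star.arrows}
  id σ := ⟨𝟙 _, fun s hs => by rwa [Category.id_comp]⟩
  comp f g := ⟨f.1 ≫ g.1, fun s hs => by
    rw [Category.assoc]
    exact f.2 _ (g.2 s hs)⟩
  id_comp f := Subtype.ext (Category.id_comp f.1)
  comp_id f := Subtype.ext (Category.comp_id f.1)
  assoc f g h := Subtype.ext (Category.assoc f.1 g.1 h.1)

/-- The functor which sends a star to its root. -/
def rootFunctor (T : Set A) : StarAt T ⥤ A where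
  obj σ := σ.root
  map f := f.1

instance : Quiver.IsThin (StarAt T) := fun σ τ => ⟨fun f g => by
  have h (f : σ ⟶ τ) : ⟨τ.root, f.1⟩ ∈ σ.star.arrows := by
    have := f.2 _ τ.star.id_mem
    rwa [Category.comp_id] at this
  exact Subtype.ext (eq_of_heq (Sigma.mk.inj (σ.star.eq_of_fst_eq _ (h f) _ (h g) rfl)).2)⟩

lemma finite (hA : IsFiniteCategory A) (T : Set A) : Finite (StarAt T) := by
  have := hA.finite_obj
  have := Star.finite hA
  refine Finite.of_injective (fun σ => (⟨σ.root, σ.star⟩ : Σ x, Star x)) ?_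
  rintro ⟨x, hx, S⟩ ⟨y, hy, S'⟩ h
  obtain ⟨rfl, h⟩ := Sigma.mk.inj h
  obtain rfl := eq_of_heq h
  rfl

lemma skeletal (hA : IsFiniteCategory A)
    (hT : ∀ x ∈ T, ∀ y ∈ T, Nonempty (x ≅ y) → x = y) : Skeletal (StarAt T) := by
  rintro ⟨x, hx, S⟩ ⟨y, hy, S'⟩ ⟨e⟩
  obtain rfl : x = y := hT x hx y hy ⟨(rootFunctor T).mapIso e⟩
  have key {S S' : Star x} (f : (⟨x, hx, S⟩ : StarAt T) ⟶ ⟨x, hx, S'⟩) :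
      S'.arrows ⊆ S.arrows := fun s hs => by
    have := f.2 s hs
    have h1 : f.1 = 𝟙 x := hA.endo_eq_id x f.1
    rwa [h1, Category.id_comp] at this
  obtain rfl : S = S' := Star.ext ((key e.inv).antisymm (key e.hom))
  rfl

/-- The stars at a given object. -/
noncomputable def ofStar {x : A} (hx : x ∈ T) : Star x ⥤ StarAt T :=
  thinFunctor (fun S => ⟨x, hx, S⟩) fun _ _ f =>
    ⟨⟨𝟙 x, fun s hs => by rw [Category.id_comp]; exact f.le hs⟩⟩

lemma nonempty_hom_iff (hA : IsFiniteCategory A) {x : A} (hx : x ∈ T) (S : Star x) {σ : StarAt T}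
    (f : x ⟶ σ.root) : (∃ g : (⟨x, hx, S⟩ : StarAt T) ⟶ σ, g.1 = f) ↔
      S ≤ σ.star.prepend hA f := by
  constructor
  · rintro ⟨g, rfl⟩ s (rfl | ⟨s', hs', rfl⟩)
    · exact S.id_mem
    · exact g.2 s' hs'
  · exact fun h => ⟨⟨f, fun s hs => h (Or.inr ⟨s, hs, rfl⟩)⟩, rfl⟩

end StarAt

end

namespace Prederivator

section
variable {D : Prederivator.{w, v, u} 𝒟} {A : Dia 𝒟}

lemma isRan_of_iso_id {u : A ⥤ A} (α : u ≅ 𝟭 A) {Z Y : D.cat A} (t : (D.pull u).obj Z ⟶ Y)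
    [IsIso t] : IsRan u t := by
  rw [← IsRan.cell_iff α.inv]
  have := isIso_pullMap_app (D := D) α.inv Z
  exact isRan_id _

end

section
variable [IsDiagramCategory 𝒟] {D E : Prederivator.{w, v, u} 𝒟}

/-- The limit of a constant diagram over a category with a terminal object. -/
lemma isRan_toPt_of_isTerminal [D.IsDerivator] {M : Dia 𝒟} [Quiver.IsThin M] {g : Dia.pt 𝒟 ⥤ M}
    (adj : M.toPt ⊣ g) {V : D.cat (Dia.pt 𝒟)} {Y : D.cat M} (t : (D.pull M.toPt).obj V ⟶ Y)
    [IsIso t] : IsRan M.toPt t := by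
  have : g.Faithful := ⟨fun _ => Subsingleton.elim _ _⟩
  have : g.Full := ⟨fun _ => ⟨eqToHom (Subsingleton.elim _ _), Subsingleton.elim _ _⟩⟩
  have h := isRan_pullAdj adj V
  have := h.isIso_of_full_of_faithful
  rw [← Category.id_comp t, IsRan.comp_iso_iff, ← h.paste_iff]
  have h1 : IsIso (paste ((D.pullAdj adj).counit.app V) (𝟙 ((D.pull M.toPt).obj V))) := by
    rw [paste, CategoryTheory.Functor.map_id]
    exact IsIso.comp_isIso' (Iso.isIso_hom ((D.pullComp g M.toPt).app V))
      (IsIso.comp_isIso' (IsIso.id _) this)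
  exact isRan_of_iso_id (NatIso.ofComponents (fun _ => eqToIso (Subsingleton.elim _ _))
    fun _ => Subsingleton.elim _ _) _

variable {A : Dia 𝒟} {T : Set A}

/-- The stars at the objects of a skeleton of a finite category form a finite poset. -/
lemma mem_starAt (hA : IsFiniteCategory A) (hT : ∀ x ∈ T, ∀ y ∈ T, Nonempty (x ≅ y) → x = y) :
    𝒟 (Cat.of (StarAt T)) :=
  have := StarAt.finite hA T
  IsDiagramCategory.finite_poset _ (StarAt.skeletal hA hT)

/-- Every diagram on a finite category is the right Kan extension of its restriction to the poset
of stars: the stars at `x` map to the comma category by a left adjoint, whose right adjoint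
prepends an arrow, and they have a terminal object, the trivial star. -/
lemma isRan_rootFunctor [D.IsDerivator] (hA : IsFiniteCategory A)
    (hT : ∀ x, ∃ y ∈ T, Nonempty (y ≅ x))
    (h : 𝒟 (Cat.of (StarAt T))) {Z : D.cat A} {Y : D.cat (.mk (StarAt T) h)}
    (t : (D.pull (J := .mk (StarAt T) h) (StarAt.rootFunctor T)).obj Z ⟶ Y) [IsIso t] :
    IsRan (A := .mk (StarAt T) h) (StarAt.rootFunctor T) t := by
  refine isRan_of_pointwise (A := .mk (StarAt T) h) fun k => ?_
  obtain ⟨x, hx, ⟨e⟩⟩ := hT k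
  have := Star.finite hA x
  let M : Dia 𝒟 := .mk (Star x) (mem_of_partialOrder 𝒟 _)
  let α : M.toPt ⋙ Dia.point x ⟶ StarAt.ofStar hx ⋙ StarAt.rootFunctor T :=
    { app := fun _ => 𝟙 x
      naturality := fun _ _ _ => hA.endo_eq_id x _ |>.trans (hA.endo_eq_id x _).symm }
  have hα : IsIso α :=
    @NatIso.isIso_of_isIso_app _ _ _ _ _ _ _ fun _ => inferInstanceAs (IsIso (𝟙 x))
  refine ⟨x, e, M, StarAt.ofStar hx, α, ?_, ?_⟩
  · refine isLeftAdjoint_of_thin _ (fun y => y.right.star.prepend hA y.hom) fun S y => ?_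
    have h1 := StarAt.nonempty_hom_iff hA hx S y.hom
    refine Iff.trans ⟨?_, ?_⟩ (h1.trans ⟨fun h => ⟨homOfLE h⟩, fun ⟨f⟩ => f.le⟩)
    · rintro ⟨φ⟩
      exact ⟨φ.right, (Category.id_comp _).symm.trans (StructuredArrow.w φ)⟩
    · rintro ⟨g, hg⟩
      exact ⟨StructuredArrow.homMk g ((Category.id_comp _).trans hg)⟩
  · have h1 := isIso_pullMap_app (D := D) (A := M) α Z
    have h2 : IsIso (baseChange (A := .mk (StarAt T) h) α t) :=
      IsIso.comp_isIso' (Iso.isIso_hom ((D.pullComp M.toPt (Dia.point x)).symm.app Z))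
        (IsIso.comp_isIso' h1 (IsIso.comp_isIso' (Iso.isIso_hom ((D.pullComp (J := M)
          (K := .mk (StarAt T) h) (StarAt.ofStar hx) (StarAt.rootFunctor T)).app Z))
          inferInstance))
    have adj : M.toPt ⊣ Dia.point (J := M) (Star.trivial x) :=
      thinAdjunction _ _ fun S _ => ⟨fun _ => ⟨homOfLE S.le_trivial⟩,
        fun _ => ⟨eqToHom (Subsingleton.elim _ _)⟩⟩
    exact isRan_toPt_of_isTerminal adj _

lemma exists_skeleton (A : Type w) [SmallCategory A] : ∃ T : Set A,
    (∀ x ∈ T, ∀ y ∈ T, Nonempty (x ≅ y) → x = y) ∧ ∀ x, ∃ y ∈ T, Nonempty (y ≅ x) := by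
  refine ⟨Set.range fun c : Quotient (isIsomorphicSetoid A) => c.out, ?_, fun x =>
    ⟨_, ⟨Quotient.mk _ x, rfl⟩, Quotient.mk_out (s := isIsomorphicSetoid A) x⟩⟩
  rintro _ ⟨c, rfl⟩ _ ⟨d, rfl⟩ h
  have : c = d := by
    rw [← Quotient.out_eq c, ← Quotient.out_eq d]
    exact Quotient.sound (s := isIsomorphicSetoid A) h
  rw [this]

lemma commutesWithFiniteLimits_of_poset [D.IsDerivator] [E.IsDerivator] {L : D ⟶ E}
    (h : ∀ (P : Dia 𝒟) [Finite P] [Quiver.IsThin P], Skeletal P → CommutesWithRan L P.toPt) :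
    CommutesWithFiniteLimits L := by
  intro A hA
  obtain ⟨T, hT, hT'⟩ := exists_skeleton A
  let P : Dia 𝒟 := .mk (StarAt T) (mem_starAt hA hT)
  have : Finite P := StarAt.finite hA T
  have : Quiver.IsThin P := inferInstanceAs (Quiver.IsThin (StarAt T))
  have hP := (commutesWithRan_iff L).1 (h P (StarAt.skeletal hA hT))
  rw [commutesWithRan_iff]
  intro Z Y t ht
  have h1 : IsRan (A := P) (StarAt.rootFunctor T)
      (𝟙 ((D.pull (J := P) (StarAt.rootFunctor T)).obj Y)) := isRan_rootFunctor hA hT' _ _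
  have h2 := hP _ (h1.paste_iff.2 ht)
  have h3 : IsIso (mapCone L (𝟙 ((D.pull (J := P) (StarAt.rootFunctor T)).obj Y))) := by
    rw [mapCone, CategoryTheory.Functor.map_id]
    exact IsIso.comp_isIso' (Iso.isIso_hom ((natIso L _).symm.app Y)) (IsIso.id _)
  have h4 : IsRan (A := P) (StarAt.rootFunctor T)
      (mapCone L (𝟙 ((D.pull (J := P) (StarAt.rootFunctor T)).obj Y))) :=
    isRan_rootFunctor hA hT' _ _
  erw [mapCone_paste] at h2
  exact h4.paste_iff.1 h2

end

end Prederivator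

end Derivators

theorem mainTheorem2 {𝒟 : CategoryTheory.ObjectProperty CategoryTheory.Cat.{w, w}}
    [Derivators.IsDiagramCategory 𝒟] {D E : Derivators.Prederivator.{w, v, u} 𝒟}
    [D.IsDerivator] [E.IsDerivator] (L : D ⟶ E) (R : E ⟶ D)
    (adj : CategoryTheory.Bicategory.Adjunction L R)
    (hLR : Derivators.IsChoricReflection adj) :
    List.TFAE [
      Derivators.CommutesWithFiniteLimits L,
      Derivators.IsLeftExact L,
      Derivators.LocalsPullbackStable L,
      Derivators.LocalsClosedUnderFiniteRan L] := by
  tfae_have 1 → 2 := Derivators.Prederivator.IsLeftExact.of_commutesWithFiniteLimits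
  tfae_have 2 → 4 := Derivators.Prederivator.IsLeftExact.localsClosedUnderFiniteRan
  tfae_have 4 → 3 := Derivators.Prederivator.LocalsClosedUnderFiniteRan.localsPullbackStable
  tfae_have 3 → 1 := fun h =>
    Derivators.Prederivator.commutesWithFiniteLimits_of_poset fun _ _ _ hP =>
      Derivators.Prederivator.LocalsPullbackStable.commutesWithRan_of_poset adj hLR h hP
  tfae_finish
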